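/- **Theorem (2-dimensional reverse isoperimetric inequality).** Let $\lambda>0$. A convex body in $\mathbb{R}^2$ (a compact convex set with non-empty interior) $K$ is called *$\lambda$-convex* if for every $p\in\partial K$ there are a neighbourhood $U_p$ of $p$ and a closed disk $\mathcal{B}$ of radius $1/\lambda$ with $p\in\partial\mathcal{B}$ such that $U_p\cap\partial K\subset\mathcal{B}$. A *$\lambda$-convex lens* is the intersection of two distinct closed disks of radius $1/\lambda$, provided that this intersection has non-empty interior. Write $|\cdot|$ for area and $|\partial\,\cdot\,|$ for the length of the boundary. Let $K\subset\mathbb{R}^2$ be a $\lambda$-convex body and let $L\subset\mathbb{R}^2$ be a $\lambda$-convex lens with $|\partial K|=|\partial L|$. Then $|K|\ge|L|$, and equality $|K|=|L|$ is possible only if $K$ is a $\lambda$-convex lens. -/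

import Mathlib

open MeasureTheory Topology

/-- A `lam`-convex body in the Euclidean plane: a compact convex set with non-empty interior such
that through every boundary point `p` passes a circle of radius `1 / lam` whose closed disk contains
the part of the boundary of `K` in some neighbourhood of `p`. -/
structure IsLambdaConvexBody (lam : ℝ) (K : Set (EuclideanSpace ℝ (Fin 2))) : Prop where
  isCompact : IsCompact K
  convex : Convex ℝ K
  interior_nonempty : (interior K).Nonempty
  locally_supported : ∀ p ∈ frontier K, ∃ U ∈ 𝓝 p, ∃ c : EuclideanSpace ℝ (Fin 2),
    p ∈ Metric.sphere c (1 / lam) ∧ U ∩ frontier K ⊆ Metric.closedBall c (1 / lam)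

/-- A `lam`-convex lens in the Euclidean plane: the intersection of two distinct closed disks of
radius `1 / lam`, having non-empty interior. -/
def IsLambdaConvexLens (lam : ℝ) (L : Set (EuclideanSpace ℝ (Fin 2))) : Prop :=
  ∃ c₁ c₂ : EuclideanSpace ℝ (Fin 2), c₁ ≠ c₂ ∧
    L = Metric.closedBall c₁ (1 / lam) ∩ Metric.closedBall c₂ (1 / lam) ∧ (interior L).Nonempty

/-- The perimeter `|∂K|`: the one-dimensional Hausdorff measure of the boundary. -/
noncomputable def perimeter (K : Set (EuclideanSpace ℝ (Fin 2))) : ENNReal :=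
  Measure.hausdorffMeasure 1 (frontier K)

/-! Put R = 1/λ. Each normal angle θ has a unique support point X(θ), and the local disk condition
globalizes: K lies in the disk of radius R with centre X(θ) - R u(θ), where u is the outer normal
(`IsLambdaConvexBody.exists_isSupportCurve`). Hence X is R-Lipschitz, and almost everywhere X' is r
times the unit tangent with 0 ≤ r ≤ R. The perimeter is the integral of r over a period
(`perimeter_eq`), and twice the area is at least the integral of ⟨X - p, u⟩ r for an interior point
p (`integral_le_volume`).

Cut K along the chord from X(a) to X(a + π). The boundary terms of the halves cancel, and with ρ =
r/R the half starting at a contributes R² times J, the integral of sin(θ - t) ρ(t) ρ(θ) over a < t ≤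
θ ≤ a + π. The main estimate is J ≥ ℓ - sin ℓ, where ℓ is the integral of ρ over the half
(`sub_sin_le_integral`). Let S be a primitive of ρ and δ = S(θ) - S(t). The excess (θ - t) - δ lies
in [0, π - ℓ], so by concavity sin(θ - t) is at least the chord of the sine over [δ, π - ℓ + δ]. The
constant term sin δ of the chord integrates to ℓ - sin ℓ. The linear term integrates to 0, since
sin(ℓ - δ) - sin δ is antisymmetric under δ ↦ ℓ - δ. Convexity of x - sin x, applied to the two
halves, gives area ≥ R²(m - sin m) when the perimeter is 2Rm. A lens of that perimeter has at most
this area (`IsLambdaConvexLens.exists_perimeter_volume`).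

In the equality case every half has ℓ = m, and almost every pair charged by ρ has excess 0 or π - m.
So ρ vanishes while θ - S(θ) climbs between two levels π - m apart, which yields an interval of
length π - m without curvature (`exists_gap`). The complementary intervals, of length m, must then
have ρ = 1: the boundary is two arcs and two vertices (`exists_lens_of_gap`). -/

open Set Filter
open scoped RealInnerProductSpace Real

/-! ### Rotating orthonormal frames in the plane. -/

/-- The Euclidean plane. -/
abbrev Plane := EuclideanSpace ℝ (Fin 2)

/-- The unit vector of argument `θ`. -/
noncomputable def unitVec (θ : ℝ) : Plane := !₂[Real.cos θ, Real.sin θ]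

/-- The unit vector of argument `θ` turned by a right angle. -/
noncomputable def tangentVec (θ : ℝ) : Plane := !₂[-Real.sin θ, Real.cos θ]

theorem inner_plane (x y : Plane) : ⟪x, y⟫ = x 0 * y 0 + x 1 * y 1 := by
  simp [PiLp.inner_apply, Fin.sum_univ_two, mul_comm]

@[simp] theorem unitVec_zero (θ : ℝ) : unitVec θ 0 = Real.cos θ := by simp [unitVec]
@[simp] theorem unitVec_one (θ : ℝ) : unitVec θ 1 = Real.sin θ := by simp [unitVec]
@[simp] theorem tangentVec_zero (θ : ℝ) : tangentVec θ 0 = -Real.sin θ := by simp [tangentVec]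
@[simp] theorem tangentVec_one (θ : ℝ) : tangentVec θ 1 = Real.cos θ := by simp [tangentVec]

theorem plane_ext {x y : Plane} (h0 : x 0 = y 0) (h1 : x 1 = y 1) : x = y := by
  ext i; fin_cases i <;> assumption

theorem inner_unitVec_unitVec (a b : ℝ) : ⟪unitVec a, unitVec b⟫ = Real.cos (a - b) := by
  rw [inner_plane, Real.cos_sub]; simp

theorem inner_unitVec_tangentVec (a b : ℝ) : ⟪unitVec a, tangentVec b⟫ = Real.sin (a - b) := by
  rw [inner_plane, Real.sin_sub]; simp; ring

theorem inner_tangentVec_unitVec (a b : ℝ) : ⟪tangentVec a, unitVec b⟫ = Real.sin (b - a) := by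
  rw [real_inner_comm, inner_unitVec_tangentVec]

theorem inner_tangentVec_tangentVec (a b : ℝ) :
    ⟪tangentVec a, tangentVec b⟫ = Real.cos (a - b) := by
  rw [inner_plane, Real.cos_sub]; simp; ring

theorem norm_unitVec (θ : ℝ) : ‖unitVec θ‖ = 1 := by
  have h := real_inner_self_eq_norm_sq (unitVec θ)
  rw [inner_unitVec_unitVec, sub_self, Real.cos_zero] at h
  nlinarith [norm_nonneg (unitVec θ)]

theorem norm_tangentVec (θ : ℝ) : ‖tangentVec θ‖ = 1 := by
  have h := real_inner_self_eq_norm_sq (tangentVec θ)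
  rw [inner_tangentVec_tangentVec, sub_self, Real.cos_zero] at h
  nlinarith [norm_nonneg (tangentVec θ)]

theorem norm_sq_eq_inner_unitVec (w : Plane) (θ : ℝ) :
    ‖w‖ ^ 2 = ⟪w, unitVec θ⟫ ^ 2 + ⟪w, tangentVec θ⟫ ^ 2 := by
  rw [← real_inner_self_eq_norm_sq]
  simp only [inner_plane, unitVec_zero, unitVec_one, tangentVec_zero, tangentVec_one]
  have h := Real.sin_sq_add_cos_sq θ
  linear_combination (-(w 0 ^ 2 + w 1 ^ 2)) * h

theorem inner_eq_frame (w z : Plane) (θ : ℝ) :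
    ⟪w, z⟫ = ⟪w, unitVec θ⟫ * ⟪z, unitVec θ⟫ + ⟪w, tangentVec θ⟫ * ⟪z, tangentVec θ⟫ := by
  simp only [inner_plane, unitVec_zero, unitVec_one, tangentVec_zero, tangentVec_one]
  have h := Real.sin_sq_add_cos_sq θ
  linear_combination (-(w 0 * z 0 + w 1 * z 1)) * h

theorem inner_unitVec_eq_frame (w : Plane) (θ φ : ℝ) :
    ⟪w, unitVec φ⟫ =
      ⟪w, unitVec θ⟫ * Real.cos (φ - θ) + ⟪w, tangentVec θ⟫ * Real.sin (φ - θ) := by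
  rw [inner_eq_frame w (unitVec φ) θ, inner_unitVec_unitVec, inner_unitVec_tangentVec]

/-- For `a ≤ t ≤ b < a + π` this writes `unitVec t` as a nonnegative combination of `unitVec a` and
`unitVec b`, so that inequalities at two normals pass to all normals between them. -/
theorem sin_mul_inner_unitVec (w : Plane) (a b t : ℝ) : Real.sin (b - a) * ⟪w, unitVec t⟫ =
    Real.sin (b - t) * ⟪w, unitVec a⟫ + Real.sin (t - a) * ⟪w, unitVec b⟫ := by
  simp only [inner_plane, unitVec_zero, unitVec_one, Real.sin_sub]
  ring

theorem eq_of_inner_frame {w z : Plane} (θ : ℝ) (h1 : ⟪w, unitVec θ⟫ = ⟪z, unitVec θ⟫)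
    (h2 : ⟪w, tangentVec θ⟫ = ⟪z, tangentVec θ⟫) : w = z := by
  have h := norm_sq_eq_inner_unitVec (w - z) θ
  rw [inner_sub_left, inner_sub_left, h1, h2] at h
  have h0 : ‖w - z‖ = 0 := by
    have : ‖w - z‖ ^ 2 = 0 := by rw [h]; ring
    exact pow_eq_zero_iff (two_ne_zero) |>.1 this
  exact sub_eq_zero.1 (norm_eq_zero.1 h0)

theorem hasDerivAt_plane {f : ℝ → Plane} {f' : Plane} {t : ℝ}
    (h0 : HasDerivAt (fun s => f s 0) (f' 0) t) (h1 : HasDerivAt (fun s => f s 1) (f' 1) t) :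
    HasDerivAt f f' t := by
  have h : HasDerivAt (fun s i => f s i) (fun i => f' i) t :=
    hasDerivAt_pi.2 fun i => by fin_cases i <;> assumption
  exact (PiLp.hasFDerivAt_toLp (𝕜 := ℝ) 2 (fun i => f t i)).comp_hasDerivAt t h

theorem hasDerivAt_unitVec (θ : ℝ) : HasDerivAt unitVec (tangentVec θ) θ := by
  apply hasDerivAt_plane
  · simpa using Real.hasDerivAt_cos θ
  · simpa using Real.hasDerivAt_sin θ

theorem hasDerivAt_tangentVec (θ : ℝ) : HasDerivAt tangentVec (-unitVec θ) θ := by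
  apply hasDerivAt_plane
  · simpa using (Real.hasDerivAt_sin θ).fun_neg
  · simpa using Real.hasDerivAt_cos θ

theorem continuous_unitVec : Continuous unitVec :=
  continuous_iff_continuousAt.2 fun θ => (hasDerivAt_unitVec θ).continuousAt

theorem continuous_tangentVec : Continuous tangentVec :=
  continuous_iff_continuousAt.2 fun θ => (hasDerivAt_tangentVec θ).continuousAt

theorem hasDerivAt_inner_unitVec (w : Plane) (θ : ℝ) :
    HasDerivAt (fun φ => ⟪w, unitVec φ⟫) ⟪w, tangentVec θ⟫ θ := by
  have h := ((innerSL ℝ w).hasFDerivAt (x := unitVec θ)).comp_hasDerivAt θ (hasDerivAt_unitVec θ)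
  simpa [Function.comp_def] using h

theorem unitVec_add_pi (θ : ℝ) : unitVec (θ + π) = -unitVec θ := by
  apply plane_ext <;> simp [Real.cos_add_pi, Real.sin_add_pi]

theorem unitVec_add_two_pi (θ : ℝ) : unitVec (θ + 2 * π) = unitVec θ := by
  simp [unitVec]

theorem norm_unitVec_sub_le (a b : ℝ) : ‖unitVec a - unitVec b‖ ≤ |a - b| := by
  have h : ∀ x, ‖deriv unitVec x‖ ≤ 1 := fun x => by
    rw [(hasDerivAt_unitVec x).deriv, norm_tangentVec]
  have := Convex.norm_image_sub_le_of_norm_deriv_le (s := univ)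
    (fun x _ => (hasDerivAt_unitVec x).differentiableAt) (fun x _ => h x) convex_univ
    (mem_univ b) (mem_univ a)
  simpa using this

/-- Every unit vector has an argument in any given half-open interval of length `2π`. -/
theorem exists_unitVec_eq {w : Plane} (hw : ‖w‖ = 1) (a : ℝ) :
    ∃ θ ∈ Ico a (a + 2 * π), unitVec θ = w := by
  have hz : ‖(⟨w 0, w 1⟩ : ℂ)‖ = 1 := by
    have h1 : w 0 * w 0 + w 1 * w 1 = 1 := by
      rw [← inner_plane, real_inner_self_eq_norm_sq, hw]; norm_num
    rw [Complex.norm_eq_sqrt_sq_add_sq]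
    simp only
    rw [show w 0 ^ 2 + w 1 ^ 2 = 1 by linarith [h1], Real.sqrt_one]
  have hne : (⟨w 0, w 1⟩ : ℂ) ≠ 0 := by
    intro h; rw [h] at hz; simp at hz
  set φ := Complex.arg ⟨w 0, w 1⟩ with hφ
  have hc : Real.cos φ = w 0 := by rw [hφ, Complex.cos_arg hne, hz]; simp
  have hs : Real.sin φ = w 1 := by rw [hφ, Complex.sin_arg, hz]; simp
  refine ⟨toIcoMod Real.two_pi_pos a φ, toIcoMod_mem_Ico _ _ _, ?_⟩
  have hk : toIcoMod Real.two_pi_pos a φ = φ - toIcoDiv Real.two_pi_pos a φ * (2 * π) := by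
    rw [toIcoMod, zsmul_eq_mul]
  apply plane_ext
  · rw [unitVec_zero, hk, Real.cos_sub_int_mul_two_pi, hc]
  · rw [unitVec_one, hk, Real.sin_sub_int_mul_two_pi, hs]

/-! ### Support curves; from local to global supporting disks. -/

/-- A curve `X` parametrizes the boundary of `K` by the outer normal angle and every supporting disk
of radius `R` contains `K`. -/
structure IsSupportCurve (R : ℝ) (K : Set Plane) (X : ℝ → Plane) : Prop where
  mem : ∀ θ, X θ ∈ K
  support : ∀ θ, ∀ y ∈ K, ⟪y, unitVec θ⟫ ≤ ⟪X θ, unitVec θ⟫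
  ball : ∀ θ, K ⊆ Metric.closedBall (X θ - R • unitVec θ) R

theorem mem_frontier_of_support {K : Set Plane} {θ : ℝ} {x : Plane} (hx : x ∈ K)
    (h : ∀ y ∈ K, ⟪y, unitVec θ⟫ ≤ ⟪x, unitVec θ⟫) : x ∈ frontier K := by
  refine ⟨subset_closure hx, fun hi => ?_⟩
  have ht : Tendsto (fun ε : ℝ => x + ε • unitVec θ) (𝓝[>] 0) (𝓝 x) := by
    have : Continuous fun ε : ℝ => x + ε • unitVec θ := by fun_prop
    have h0 := this.tendsto 0
    simp only [zero_smul, add_zero] at h0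
    exact h0.mono_left nhdsWithin_le_nhds
  obtain ⟨ε, h1, h2⟩ := ((ht.eventually (mem_interior_iff_mem_nhds.1 hi)).and
    self_mem_nhdsWithin).exists
  have := h _ h1
  rw [inner_add_left, real_inner_smul_left, inner_unitVec_unitVec, sub_self, Real.cos_zero] at this
  have h2' : (0 : ℝ) < ε := h2
  linarith

section LocalToGlobal

variable {K : Set Plane} {X : ℝ → Plane}

/-- By compactness it suffices to identify cluster points, and a limit of maximizers is a maximizer
in the limit direction. -/
theorem continuous_of_unique_support (hK : IsCompact K) (hX : ∀ θ, X θ ∈ K)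
    (hmax : ∀ θ, ∀ y ∈ K, ⟪y, unitVec θ⟫ ≤ ⟪X θ, unitVec θ⟫)
    (huniq : ∀ θ, ∀ y ∈ K, ⟪y, unitVec θ⟫ = ⟪X θ, unitVec θ⟫ → y = X θ) : Continuous X := by
  refine continuous_iff_continuousAt.2 fun θ => ?_
  refine hK.tendsto_nhds_of_unique_mapClusterPt (Eventually.of_forall hX) fun y hy hcl => ?_
  obtain ⟨U, hU, hUy⟩ := mapClusterPt_iff_ultrafilter.1 hcl
  refine huniq θ y hy (le_antisymm (hmax θ y hy) ?_)
  have hu : Tendsto unitVec U (𝓝 (unitVec θ)) := (continuous_unitVec.tendsto θ).mono_left hU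
  exact le_of_tendsto_of_tendsto' (tendsto_const_nhds.inner hu) (hUy.inner hu)
    fun φ => hmax φ _ (hX θ)

/-- Envelope argument: moving the support point contributes at most `‖X φ - X θ‖ * |φ - θ|`, which
is of lower order by continuity, so only the normal is differentiated. -/
theorem hasDerivAt_support (hX : ∀ θ, X θ ∈ K)
    (hmax : ∀ θ, ∀ y ∈ K, ⟪y, unitVec θ⟫ ≤ ⟪X θ, unitVec θ⟫) (hc : Continuous X) (θ : ℝ) :
    HasDerivAt (fun φ => ⟪X φ, unitVec φ⟫) ⟪X θ, tangentVec θ⟫ θ := by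
  have key : HasDerivAt (fun φ => ⟪X φ - X θ, unitVec φ⟫) 0 θ := by
    rw [hasDerivAt_iff_isLittleO]
    simp only [sub_self, inner_zero_left, sub_zero, smul_zero]
    rw [Asymptotics.isLittleO_iff]
    intro c hc0
    have h1 : ∀ᶠ φ in 𝓝 θ, ‖X φ - X θ‖ ≤ c := by
      have : Tendsto (fun φ => ‖X φ - X θ‖) (𝓝 θ) (𝓝 0) := by
        have h := ((hc.sub continuous_const).norm).tendsto (f := fun φ => ‖X φ - X θ‖) θ
        simpa using h
      exact this.eventually (ge_mem_nhds hc0)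
    filter_upwards [h1] with φ hφ
    have h2 : 0 ≤ ⟪X φ - X θ, unitVec φ⟫ := by
      rw [inner_sub_left]; linarith [hmax φ _ (hX θ)]
    have h3 : ⟪X φ - X θ, unitVec φ⟫ ≤ ⟪X φ - X θ, unitVec φ - unitVec θ⟫ := by
      rw [inner_sub_right, inner_sub_left (X φ) (X θ) (unitVec θ)]
      linarith [hmax θ _ (hX φ)]
    rw [Real.norm_of_nonneg h2, Real.norm_eq_abs]
    calc _ ≤ _ := h3
      _ ≤ ‖X φ - X θ‖ * ‖unitVec φ - unitVec θ‖ := real_inner_le_norm _ _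
      _ ≤ c * |φ - θ| := by
        gcongr
        exact norm_unitVec_sub_le _ _
  have h := key.add (hasDerivAt_inner_unitVec (X θ) θ)
  rw [zero_add] at h
  refine h.congr_of_eventuallyEq (Eventually.of_forall fun φ => ?_)
  simp [inner_sub_left]

/-- A boundary point at which the boundary lies locally in a disk of radius `R` admits no interior
supporting disk of larger radius. -/
theorem not_eventually_outside {R R' θ : ℝ} {c : Plane} (hR : 0 < R) (hRR : R < R')
    (hle : ∀ φ, ⟪X φ, unitVec θ⟫ ≤ ⟪X θ, unitVec θ⟫)
    (hc : ‖X θ - c‖ = R) (hball : ∀ᶠ φ in 𝓝 θ, ‖X φ - c‖ ≤ R)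
    (hout : ∀ᶠ φ in 𝓝 θ,
      ⟪X θ, unitVec φ⟫ + R' * (1 - Real.cos (φ - θ)) ≤ ⟪X φ, unitVec φ⟫) : False := by
  set α := ⟪X θ - c, unitVec θ⟫ with hα
  set β := ⟪X θ - c, tangentVec θ⟫ with hβ
  have hαβ : α ^ 2 + β ^ 2 = R ^ 2 := by rw [← hc, norm_sq_eq_inner_unitVec (X θ - c) θ]
  have hαR : |α| ≤ R := abs_le_of_sq_le_sq (by nlinarith) hR.le
  have hlim : ∀ σ : ℝ, σ ^ 2 = 1 → Tendsto (fun t : ℝ => θ + σ * t) (𝓝[>] 0) (𝓝 θ) := by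
    intro σ _
    have : Continuous fun t : ℝ => θ + σ * t := by fun_prop
    have h0 := this.tendsto 0
    simp only [mul_zero, add_zero] at h0
    exact h0.mono_left nhdsWithin_le_nhds
  have hsmall : ∀ᶠ t : ℝ in 𝓝[>] 0, 0 < t ∧ t < π / 2 := by
    refine Ioo_mem_nhdsGT (by positivity)
  -- The centre `c` is not known to lie on the normal at `X θ`. Approaching `θ` from both sides
  -- bounds `β` and `-β` by a quantity tending to 0.
  have step : ∀ σ : ℝ, σ ^ 2 = 1 → ∀ᶠ t : ℝ in 𝓝[>] 0, σ * β ≤ R * Real.tan t := by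
    intro σ hσ
    filter_upwards [(hlim σ hσ).eventually hball, (hlim σ hσ).eventually hout, hsmall]
      with t h1 h2 ⟨h3, h4⟩
    have hcosσ : Real.cos (σ * t) = Real.cos t := by
      rcases eq_or_eq_neg_of_sq_eq_sq σ 1 (by rw [hσ, one_pow]) with h | h <;> simp [h]
    have hsinσ : Real.sin (σ * t) = σ * Real.sin t := by
      rcases eq_or_eq_neg_of_sq_eq_sq σ 1 (by rw [hσ, one_pow]) with h | h <;> simp [h]
    set d := X (θ + σ * t) - X θ with hd
    set b := ⟪d, unitVec θ⟫ with hb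
    set a := ⟪d, tangentVec θ⟫ with ha
    have hb0 : b ≤ 0 := by rw [hb, hd, inner_sub_left]; linarith [hle (θ + σ * t)]
    have h5 : R' * (1 - Real.cos t) ≤ b * Real.cos t + a * (σ * Real.sin t) := by
      have := inner_unitVec_eq_frame d θ (θ + σ * t)
      rw [add_sub_cancel_left, hcosσ, hsinσ] at this
      rw [← this, hd, inner_sub_left]
      rw [add_sub_cancel_left, hcosσ] at h2
      linarith
    have h6 : a ^ 2 + b ^ 2 + 2 * (b * α + a * β) ≤ 0 := by
      have e : X (θ + σ * t) - c = d + (X θ - c) := by rw [hd]; abel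
      have h7 : ‖d + (X θ - c)‖ ^ 2 ≤ R ^ 2 := by
        rw [← e]; gcongr
      rw [norm_add_sq_real, hc, norm_sq_eq_inner_unitVec d θ, inner_eq_frame d (X θ - c) θ] at h7
      linarith
    have hcos : 0 < Real.cos t := Real.cos_pos_of_mem_Ioo ⟨by linarith, h4⟩
    have hcos1 : Real.cos t < 1 := by
      rw [← Real.cos_zero]
      exact Real.cos_lt_cos_of_nonneg_of_le_pi_div_two le_rfl h4.le h3
    have hsin : 0 < Real.sin t := Real.sin_pos_of_pos_of_lt_pi h3 (by linarith)
    rw [Real.tan_eq_sin_div_cos, ← mul_div_assoc, le_div_iff₀ hcos]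
    have hR'1 : 0 < R' * (1 - Real.cos t) := by
      have : 0 < R' := hR.trans hRR
      have : 0 < 1 - Real.cos t := by linarith
      positivity
    have hpos : 0 < σ * a := by
      by_contra hneg
      push Not at hneg
      linarith [mul_nonneg (neg_nonneg.2 hb0) hcos.le, mul_nonneg (neg_nonneg.2 hneg) hsin.le]
    have h8 : σ * a * (σ * β) = a * β := by linear_combination a * β * hσ
    have h9 : σ * a * (σ * β) ≤ -b * R := by
      rw [h8]
      have : -(b * α) ≤ -b * R := by
        have := mul_nonneg (neg_nonneg.2 hb0) (sub_nonneg.2 (abs_le.1 hαR).2)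
        linarith
      linarith [sq_nonneg a, sq_nonneg b]
    have h10 : -b * Real.cos t ≤ σ * a * Real.sin t := by linarith
    have h11 : σ * a * (σ * β * Real.cos t) ≤ σ * a * (R * Real.sin t) := by
      linarith [mul_le_mul_of_nonneg_right h9 hcos.le, mul_le_mul_of_nonneg_left h10 hR.le]
    exact le_of_mul_le_mul_left h11 hpos
  have htan : Tendsto (fun t : ℝ => R * Real.tan t) (𝓝[>] 0) (𝓝 0) := by
    have h : ContinuousAt Real.tan 0 := Real.continuousAt_tan.2 (by simp)
    have h0 := (h.tendsto.mono_left (nhdsWithin_le_nhds (s := Ioi 0))).const_mul R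
    simpa using h0
  have hβ0 : β = 0 := by
    have e1 := ge_of_tendsto htan (step 1 (by norm_num))
    have e2 := ge_of_tendsto htan (step (-1) (by norm_num))
    linarith
  obtain ⟨t, h1, h2, h3, h4⟩ := (((hlim 1 (by norm_num)).eventually hball).and
    (((hlim 1 (by norm_num)).eventually hout).and hsmall)).exists
  rw [one_mul] at h1 h2
  rw [add_sub_cancel_left] at h2
  have hcos1 : Real.cos t < 1 := by
    rw [← Real.cos_zero]
    exact Real.cos_lt_cos_of_nonneg_of_le_pi_div_two le_rfl h4.le h3
  have hR' : 0 < R' := hR.trans hRR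
  have h5 : ⟪X (θ + t) - c, unitVec (θ + t)⟫ ≤ R :=
    (real_inner_le_norm _ _).trans (by rw [norm_unitVec, mul_one]; exact h1)
  have h6 : ⟪X θ - c, unitVec (θ + t)⟫ = α * Real.cos t := by
    rw [inner_unitVec_eq_frame _ θ, ← hα, ← hβ, hβ0, add_sub_cancel_left]; ring
  rw [hβ0] at hαβ
  have hα' : (α - R) * (α + R) = 0 := by linear_combination hαβ
  rw [inner_sub_left] at h5 h6
  -- If `α = R`, the smaller disk is tangent on the inner side and cannot reach the larger support
  -- function. If `α = -R`, it lies beyond the supporting line, which pins the curve to `X θ`.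
  rcases mul_eq_zero.1 hα' with h | h
  · have : α = R := by linarith
    rw [this] at h6
    have := mul_pos (sub_pos.2 hRR) (sub_pos.2 hcos1)
    linarith
  · have hαn : α = -R := by linarith
    have h7 : ‖X (θ + t) - X θ‖ ^ 2 + 2 * ⟪X (θ + t) - X θ, X θ - c⟫ ≤ 0 := by
      have e : X (θ + t) - c = (X (θ + t) - X θ) + (X θ - c) := by abel
      have h8 : ‖(X (θ + t) - X θ) + (X θ - c)‖ ^ 2 ≤ R ^ 2 := by
        rw [← e]; gcongr
      rw [norm_add_sq_real, hc] at h8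
      linarith
    rw [inner_eq_frame _ _ θ, ← hα, ← hβ, hβ0, hαn, inner_sub_left (X (θ + t)) (X θ)] at h7
    have h9 : ‖X (θ + t) - X θ‖ ^ 2 ≤ 0 := by
      have := mul_nonneg (sub_nonneg.2 (hle (θ + t))) hR.le
      linarith
    have h10 : X (θ + t) - X θ = 0 := by
      rw [← norm_eq_zero]; exact pow_eq_zero_iff two_ne_zero |>.1 (le_antisymm h9 (sq_nonneg _))
    rw [sub_eq_zero.1 h10] at h2
    have := mul_pos hR' (sub_pos.2 hcos1)
    linarith

end LocalToGlobal

section LocalToGlobal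

variable {K : Set Plane} {X : ℝ → Plane}

/-- The support function of a locally `R`-supported body is nowhere touched from below by the
support function of a disk of larger radius. -/
theorem not_eventually_disk_le_support {R R' θ : ℝ} {c : Plane} (hR : 0 < R) (hRR : R < R')
    (hX : ∀ θ, X θ ∈ K) (hmax : ∀ θ, ∀ y ∈ K, ⟪y, unitVec θ⟫ ≤ ⟪X θ, unitVec θ⟫)
    (hcont : Continuous X)
    (hloc : ∃ c, ‖X θ - c‖ = R ∧ ∀ᶠ φ in 𝓝 θ, ‖X φ - c‖ ≤ R)
    (heq : R' + ⟪c, unitVec θ⟫ = ⟪X θ, unitVec θ⟫)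
    (hle : ∀ᶠ φ in 𝓝 θ, R' + ⟪c, unitVec φ⟫ ≤ ⟪X φ, unitVec φ⟫) : False := by
  obtain ⟨c', hc', hball⟩ := hloc
  -- Contact from below also equates the derivatives of the support functions, so the larger disk
  -- touches at `X θ` itself.
  have hmin : IsLocalMin (fun φ => ⟪X φ, unitVec φ⟫ - ⟪c, unitVec φ⟫) θ := by
    filter_upwards [hle] with φ hφ
    linarith
  have hd := hmin.hasDerivAt_eq_zero
    ((hasDerivAt_support hX hmax hcont θ).sub (hasDerivAt_inner_unitVec c θ))
  have hXc : X θ = c + R' • unitVec θ := by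
    apply eq_of_inner_frame θ
    · rw [inner_add_left, real_inner_smul_left, inner_unitVec_unitVec, sub_self, Real.cos_zero]
      linarith
    · rw [inner_add_left, real_inner_smul_left, inner_unitVec_tangentVec, sub_self, Real.sin_zero]
      linarith
  refine not_eventually_outside hR hRR (fun φ => hmax θ _ (hX φ)) hc' hball ?_
  filter_upwards [hle] with φ hφ
  refine le_trans (le_of_eq ?_) hφ
  rw [hXc, inner_add_left, real_inner_smul_left, inner_unitVec_unitVec, ← Real.cos_neg (θ - φ),
    neg_sub]
  ring

/-- The right side is the support function of the disk of radius `R'` tangent at `X θ`. If it is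
exceeded at `T`, a suitable translate of that disk touches the support function of `K` locally from
below at an intermediate angle, which is impossible. -/
theorem support_le_of_locally {R R' θ : ℝ} (hR : 0 < R) (hRR : R < R')
    (hX : ∀ θ, X θ ∈ K) (hmax : ∀ θ, ∀ y ∈ K, ⟪y, unitVec θ⟫ ≤ ⟪X θ, unitVec θ⟫)
    (hcont : Continuous X)
    (hloc : ∀ θ, ∃ c, ‖X θ - c‖ = R ∧ ∀ᶠ φ in 𝓝 θ, ‖X φ - c‖ ≤ R)
    {σ T : ℝ} (hσ : σ ^ 2 = 1) (hT : 0 < T) (hTπ : T < π) :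
    ⟪X (θ + σ * T), unitVec (θ + σ * T)⟫ ≤
      ⟪X θ, unitVec (θ + σ * T)⟫ + R' * (1 - Real.cos T) := by
  by_contra! hcon
  have hσσ : σ * σ = 1 := by rw [← sq, hσ]
  have hcosσ : ∀ t, Real.cos (σ * t) = Real.cos t := fun t => by
    rcases eq_or_eq_neg_of_sq_eq_sq σ 1 (by rw [hσ, one_pow]) with h | h <;> simp [h]
  have hsinσ : ∀ t, Real.sin (σ * t) = σ * Real.sin t := fun t => by
    rcases eq_or_eq_neg_of_sq_eq_sq σ 1 (by rw [hσ, one_pow]) with h | h <;> simp [h]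
  set G : ℝ → ℝ := fun t => ⟪X (θ + σ * t), unitVec (θ + σ * t)⟫ - ⟪X θ, unitVec (θ + σ * t)⟫ -
    R' * (1 - Real.cos t) with hG
  have hG0 : G 0 = 0 := by simp [hG]
  have hsinT : 0 < Real.sin T := Real.sin_pos_of_pos_of_lt_pi hT hTπ
  -- Subtracting `κ * sin t`, the effect of a translation, makes both endpoint values of `f` vanish
  -- and its initial slope negative.
  set κ := G T / Real.sin T with hκ
  have hκ0 : 0 < κ := by
    have : 0 < G T := by simp only [hG]; linarith
    positivity
  set f : ℝ → ℝ := fun t => G t - κ * Real.sin t with hf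
  have hinner : HasDerivAt (fun t : ℝ => θ + σ * t) σ 0 := by
    simpa using ((hasDerivAt_id (0 : ℝ)).const_mul σ).const_add θ
  have hGd : HasDerivAt G 0 0 := by
    have h1 := (hasDerivAt_support hX hmax hcont (θ + σ * 0)).comp (0 : ℝ) hinner
    have h2 := (hasDerivAt_inner_unitVec (X θ) (θ + σ * 0)).comp (0 : ℝ) hinner
    have h3 := ((Real.hasDerivAt_cos 0).const_sub 1).const_mul R'
    have h4 := (h1.sub h2).sub h3
    simp only [mul_zero, add_zero, sub_self, Real.sin_zero, neg_zero] at h4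
    exact h4
  have hfd : HasDerivAt f (-κ) 0 := by
    have := hGd.fun_sub ((Real.hasDerivAt_sin 0).const_mul κ)
    simpa using this
  have hGcont : Continuous G := by
    have := continuous_unitVec
    simp only [hG]
    fun_prop
  have hfcont : Continuous f := by simp only [hf]; fun_prop
  have hf0 : f 0 = 0 := by simp [hf, hG0]
  have hfT : f T = 0 := by
    simp only [hf, hκ]; field_simp; ring
  obtain ⟨t₁, ht₁, ht₁T⟩ : ∃ t, f t < 0 ∧ t ∈ Ioo 0 T := by
    have hev : ∀ᶠ t in 𝓝[>] (0 : ℝ), slope f 0 t < 0 :=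
      ((hasDerivAt_iff_tendsto_slope.1 hfd).mono_left
        (nhdsWithin_mono _ fun x hx => ne_of_gt hx)).eventually (gt_mem_nhds (by linarith))
    obtain ⟨t, h1, h2⟩ := (hev.and (Ioo_mem_nhdsGT hT)).exists
    refine ⟨t, ?_, h2⟩
    rw [slope_def_field, hf0, sub_zero, sub_zero, div_neg_iff] at h1
    rcases h1 with h | h
    · linarith [h.2, h2.1]
    · exact h.1
  have hcospos : ∀ t ∈ Icc 0 T, 0 < Real.cos (t - T / 2) := fun t ht =>
    Real.cos_pos_of_mem_Ioo ⟨by linarith [ht.1], by linarith [ht.2]⟩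
  -- Dividing by `cos (t - T / 2)`, positive on the interval, makes the lower contact function at
  -- the minimum again the effect of a translation.
  obtain ⟨t₂, ht₂, hmin⟩ := isCompact_Icc.exists_isMinOn (nonempty_Icc.2 hT.le)
    (f := fun t => f t / Real.cos (t - T / 2))
    (hfcont.continuousOn.div (by fun_prop) fun t ht => (hcospos t ht).ne')
  set q := f t₂ / Real.cos (t₂ - T / 2) with hq
  have hq0 : q < 0 := by
    have h1 : q ≤ f t₁ / Real.cos (t₁ - T / 2) := hmin (Ioo_subset_Icc_self ht₁T)
    exact h1.trans_lt (div_neg_of_neg_of_pos ht₁ (hcospos _ (Ioo_subset_Icc_self ht₁T)))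
  have ht₂' : t₂ ∈ Ioo 0 T := by
    refine ⟨lt_of_le_of_ne ht₂.1 fun h => ?_, lt_of_le_of_ne ht₂.2 fun h => ?_⟩
    · rw [hq, ← h, hf0, zero_div] at hq0; exact lt_irrefl _ hq0
    · rw [hq, h, hfT, zero_div] at hq0; exact lt_irrefl _ hq0
  -- The centre of the tangent disk after both translations.
  set c := X θ - R' • unitVec θ + (κ * σ) • tangentVec θ + q • unitVec (θ + σ * (T / 2)) with hc
  have hform : ∀ t, R' + ⟪c, unitVec (θ + σ * t)⟫ = ⟪X (θ + σ * t), unitVec (θ + σ * t)⟫ -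
      (f t - q * Real.cos (t - T / 2)) := by
    intro t
    have e1 : ⟪unitVec θ, unitVec (θ + σ * t)⟫ = Real.cos t := by
      rw [inner_unitVec_unitVec, ← Real.cos_neg, neg_sub, add_sub_cancel_left, hcosσ]
    have e2 : ⟪tangentVec θ, unitVec (θ + σ * t)⟫ = σ * Real.sin t := by
      rw [inner_tangentVec_unitVec, add_sub_cancel_left, hsinσ]
    have e3 : ⟪unitVec (θ + σ * (T / 2)), unitVec (θ + σ * t)⟫ = Real.cos (t - T / 2) := by
      rw [inner_unitVec_unitVec, ← Real.cos_neg, neg_sub, ← hcosσ (t - T / 2)]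
      congr 1; ring
    simp only [hc, inner_add_left, inner_sub_left, real_inner_smul_left, e1, e2, e3, hf, hG]
    linear_combination κ * Real.sin t * hσσ
  refine not_eventually_disk_le_support (θ := θ + σ * t₂) (c := c) hR hRR hX hmax hcont
    (hloc _) ?_ ?_
  · rw [hform, hq]
    rw [div_mul_cancel₀ _ (hcospos t₂ ht₂).ne', sub_self, sub_zero]
  · have hlim : Tendsto (fun φ => σ * (φ - θ)) (𝓝 (θ + σ * t₂)) (𝓝 t₂) := by
      have : Continuous fun φ => σ * (φ - θ) := by fun_prop
      have h0 := this.tendsto (θ + σ * t₂)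
      rwa [add_sub_cancel_left, ← mul_assoc, hσσ, one_mul] at h0
    filter_upwards [hlim.eventually (Icc_mem_nhds ht₂'.1 ht₂'.2)] with φ hφ
    have e : θ + σ * (σ * (φ - θ)) = φ := by rw [← mul_assoc, hσσ]; ring
    have h1 := hform (σ * (φ - θ))
    rw [e] at h1
    rw [h1]
    have h2 : q ≤ f (σ * (φ - θ)) / Real.cos (σ * (φ - θ) - T / 2) := hmin hφ
    rw [le_div_iff₀ (hcospos _ hφ)] at h2
    linarith

end LocalToGlobal

/-- The comparison with radii `R' > R` passes to `R` by a limit and to the opposite normal by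
closedness. A point `y` is then tested in the direction from the centre to `y`. -/
theorem IsLambdaConvexBody.exists_isSupportCurve {lam : ℝ} (hlam : 0 < lam) {K : Set Plane}
    (hK : IsLambdaConvexBody lam K) : ∃ X, IsSupportCurve (1 / lam) K X := by
  set R := 1 / lam with hRdef
  have hR : 0 < R := by positivity
  have hne : K.Nonempty := hK.interior_nonempty.mono interior_subset
  have hex : ∀ θ : ℝ, ∃ x ∈ K, ∀ y ∈ K, ⟪y, unitVec θ⟫ ≤ ⟪x, unitVec θ⟫ := fun θ => by
    obtain ⟨x, hx, h⟩ := hK.isCompact.exists_isMaxOn hne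
      (f := fun y => ⟪y, unitVec θ⟫) (by fun_prop)
    exact ⟨x, hx, fun y hy => h hy⟩
  choose X hX hmax using hex
  have huniq : ∀ θ, ∀ y ∈ K, ⟪y, unitVec θ⟫ = ⟪X θ, unitVec θ⟫ → y = X θ := by
    intro θ y hy hyX
    by_contra hyne
    have hfr : ∀ s ∈ Icc (0 : ℝ) 1, X θ + s • (y - X θ) ∈ frontier K := fun s hs => by
      refine mem_frontier_of_support (θ := θ)
        (hK.convex.add_smul_sub_mem (hX θ) hy hs) fun z hz => ?_
      rw [inner_add_left, real_inner_smul_left, inner_sub_left, hyX, sub_self, mul_zero, add_zero]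
      exact hmax θ z hz
    -- Two support points would give a boundary segment. The midpoint lies on the circle of its
    -- local disk, so points on both sides of it cannot both be in the disk.
    obtain ⟨U, hU, c, hc, hUc⟩ := hK.locally_supported _ (hfr (1 / 2) (by norm_num))
    have hlim : ∀ σ : ℝ, Tendsto (fun t : ℝ => X θ + (1 / 2 + σ * t) • (y - X θ)) (𝓝[>] 0)
        (𝓝 (X θ + (1 / 2 : ℝ) • (y - X θ))) := fun σ => by
      have : Continuous fun t : ℝ => X θ + (1 / 2 + σ * t) • (y - X θ) := by fun_prop
      have h0 := this.tendsto 0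
      simp only [mul_zero, add_zero] at h0
      exact h0.mono_left nhdsWithin_le_nhds
    obtain ⟨t, h1, h2, h3, h4⟩ := (((hlim 1).eventually hU).and (((hlim (-1)).eventually hU).and
      (Ioo_mem_nhdsGT (show (0 : ℝ) < 1 / 2 by norm_num)))).exists
    have b1 := hUc ⟨h1, hfr _ ⟨by linarith, by linarith⟩⟩
    have b2 := hUc ⟨h2, hfr _ ⟨by linarith, by linarith⟩⟩
    rw [mem_closedBall_iff_norm] at b1 b2
    rw [mem_sphere_iff_norm] at hc
    set m := X θ + (1 / 2 : ℝ) • (y - X θ) - c with hm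
    have e1 : X θ + (1 / 2 + 1 * t) • (y - X θ) - c = m + t • (y - X θ) := by
      rw [hm]; module
    have e2 : X θ + (1 / 2 + -1 * t) • (y - X θ) - c = m - t • (y - X θ) := by
      rw [hm]; module
    rw [e1] at b1
    rw [e2] at b2
    have hpar := parallelogram_law_with_norm ℝ m (t • (y - X θ))
    have hpos : 0 < ‖t • (y - X θ)‖ := by
      rw [norm_pos_iff]; exact smul_ne_zero h3.ne' (sub_ne_zero.2 hyne)
    rw [hc] at hpar
    have := mul_self_le_mul_self (norm_nonneg _) b1
    have := mul_self_le_mul_self (norm_nonneg _) b2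
    have := mul_pos hpos hpos
    linarith
  have hcont := continuous_of_unique_support hK.isCompact hX hmax huniq
  have hloc : ∀ θ, ∃ c, ‖X θ - c‖ = R ∧ ∀ᶠ φ in 𝓝 θ, ‖X φ - c‖ ≤ R := by
    intro θ
    have hfr : ∀ φ, X φ ∈ frontier K := fun φ => mem_frontier_of_support (hX φ) (hmax φ)
    obtain ⟨U, hU, c, hc, hUc⟩ := hK.locally_supported _ (hfr θ)
    refine ⟨c, mem_sphere_iff_norm.1 hc, ?_⟩
    filter_upwards [(hcont.tendsto θ).eventually hU] with φ hφ
    exact mem_closedBall_iff_norm.1 (hUc ⟨hφ, hfr φ⟩)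
  have hopen : ∀ θ, ∀ σ T : ℝ, σ ^ 2 = 1 → T ∈ Ioo 0 π →
      ⟪X (θ + σ * T), unitVec (θ + σ * T)⟫ ≤
        ⟪X θ, unitVec (θ + σ * T)⟫ + R * (1 - Real.cos T) := by
    intro θ σ T hσ hT
    have hlim : Tendsto (fun R' => ⟪X θ, unitVec (θ + σ * T)⟫ + R' * (1 - Real.cos T)) (𝓝[>] R)
        (𝓝 (⟪X θ, unitVec (θ + σ * T)⟫ + R * (1 - Real.cos T))) := by
      refine Tendsto.mono_left ?_ nhdsWithin_le_nhds
      exact (by fun_prop : Continuous fun R' =>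
        ⟪X θ, unitVec (θ + σ * T)⟫ + R' * (1 - Real.cos T)).tendsto R
    refine ge_of_tendsto hlim ?_
    filter_upwards [self_mem_nhdsWithin] with R' hR'
    exact support_le_of_locally hR hR' hX hmax hcont hloc hσ hT.1 hT.2
  have hclosed : ∀ θ, ∀ σ T : ℝ, σ ^ 2 = 1 → T ∈ Icc 0 π →
      ⟪X (θ + σ * T), unitVec (θ + σ * T)⟫ ≤
        ⟪X θ, unitVec (θ + σ * T)⟫ + R * (1 - Real.cos T) := by
    intro θ σ T hσ hT
    have hcl : IsClosed {T : ℝ | ⟪X (θ + σ * T), unitVec (θ + σ * T)⟫ ≤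
        ⟪X θ, unitVec (θ + σ * T)⟫ + R * (1 - Real.cos T)} := by
      have := continuous_unitVec
      exact isClosed_le (by fun_prop) (by fun_prop)
    have := hcl.closure_subset_iff.2 (fun T hT => hopen θ σ T hσ hT)
    rw [closure_Ioo Real.pi_pos.ne] at this
    exact this hT
  refine ⟨X, hX, hmax, fun θ y hy => ?_⟩
  rw [mem_closedBall_iff_norm]
  set c := X θ - R • unitVec θ with hcdef
  rcases eq_or_ne (y - c) 0 with h0 | h0
  · rw [h0, norm_zero]; exact hR.le
  have hpos : 0 < ‖y - c‖ := norm_pos_iff.2 h0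
  obtain ⟨φ, hφ, hφw⟩ := exists_unitVec_eq (w := ‖y - c‖⁻¹ • (y - c))
    (by rw [norm_smul, norm_inv, norm_norm, inv_mul_cancel₀ hpos.ne']) (θ - π)
  have hin : ⟪y - c, unitVec φ⟫ = ‖y - c‖ := by
    rw [hφw, real_inner_smul_right, real_inner_self_eq_norm_sq]
    field_simp
  obtain ⟨σ, T, hσ, hT, hφe⟩ : ∃ σ T : ℝ, σ ^ 2 = 1 ∧ T ∈ Icc 0 π ∧ φ = θ + σ * T := by
    rcases le_total θ φ with h | h
    · exact ⟨1, φ - θ, by norm_num, ⟨by linarith, by linarith [hφ.2]⟩, by ring⟩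
    · exact ⟨-1, θ - φ, by norm_num, ⟨by linarith, by linarith [hφ.1]⟩, by ring⟩
  have h1 := hclosed θ σ T hσ hT
  rw [← hφe] at h1
  have h2 : ⟪c, unitVec φ⟫ = ⟪X θ, unitVec φ⟫ - R * Real.cos T := by
    rw [hcdef, inner_sub_left, real_inner_smul_left, inner_unitVec_unitVec, hφe]
    congr 2
    rcases eq_or_eq_neg_of_sq_eq_sq σ 1 (by rw [hσ, one_pow]) with h | h <;> simp [h]
  rw [← hin, inner_sub_left, h2]
  linarith [hmax φ y hy]

/-! ### Lipschitz regularity and the radius of curvature. -/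

/-- The radius of curvature of a curve parametrized by its normal angle. -/
noncomputable def curvRadius (X : ℝ → Plane) (θ : ℝ) : ℝ := ⟪deriv X θ, tangentVec θ⟫

namespace IsSupportCurve

variable {R : ℝ} {K : Set Plane} {X : ℝ → Plane}

/-- The disk condition expanded about `X θ`: a quantitative strict convexity, giving uniqueness of
support points and the Lipschitz bound. -/
theorem sq_norm_sub_le (hX : IsSupportCurve R K X) (hR : 0 < R) (θ : ℝ) {y : Plane} (hy : y ∈ K) :
    ‖y - X θ‖ ^ 2 + 2 * R * ⟪y - X θ, unitVec θ⟫ ≤ 0 := by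
  have h := mem_closedBall_iff_norm.1 (hX.ball θ hy)
  have e : y - (X θ - R • unitVec θ) = (y - X θ) + R • unitVec θ := by abel
  rw [e] at h
  have h2 : ‖(y - X θ) + R • unitVec θ‖ ^ 2 ≤ R ^ 2 := by gcongr
  rw [norm_add_sq_real, norm_smul, norm_unitVec, real_inner_smul_right, Real.norm_of_nonneg hR.le]
    at h2
  linarith

theorem eq_of_inner_eq (hX : IsSupportCurve R K X) (hR : 0 < R) (θ : ℝ) {y : Plane} (hy : y ∈ K)
    (h : ⟪y, unitVec θ⟫ = ⟪X θ, unitVec θ⟫) : y = X θ := by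
  have h1 := hX.sq_norm_sub_le hR θ hy
  rw [inner_sub_left, h, sub_self, mul_zero, add_zero] at h1
  exact sub_eq_zero.1 (norm_eq_zero.1 (pow_eq_zero_iff two_ne_zero |>.1
    (le_antisymm h1 (sq_nonneg _))))

theorem periodic (hX : IsSupportCurve R K X) (hR : 0 < R) (θ : ℝ) : X (θ + 2 * π) = X θ := by
  refine hX.eq_of_inner_eq hR θ (hX.mem _) (le_antisymm (hX.support _ _ (hX.mem _)) ?_)
  have := hX.support (θ + 2 * π) _ (hX.mem θ)
  rwa [unitVec_add_two_pi] at this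

/-- Adding the strict convexity estimates at `a` and `b` gives `‖X a - X b‖² ≤ R ⟪X a - X b, unitVec
a - unitVec b⟫`. -/
theorem norm_sub_le (hX : IsSupportCurve R K X) (hR : 0 < R) (a b : ℝ) :
    ‖X a - X b‖ ≤ R * |a - b| := by
  have h1 := hX.sq_norm_sub_le hR b (hX.mem a)
  have h2 := hX.sq_norm_sub_le hR a (hX.mem b)
  rw [← neg_sub (X a) (X b), norm_neg, inner_neg_left] at h2
  have h3 : ‖X a - X b‖ ^ 2 ≤ R * ⟪X a - X b, unitVec a - unitVec b⟫ := by
    rw [inner_sub_right]; linarith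
  have h4 : ⟪X a - X b, unitVec a - unitVec b⟫ ≤ ‖X a - X b‖ * |a - b| :=
    (real_inner_le_norm _ _).trans (by gcongr; exact norm_unitVec_sub_le a b)
  rcases (norm_nonneg (X a - X b)).eq_or_lt with h0 | h0
  · rw [← h0]; positivity
  · have h5 : ‖X a - X b‖ * ‖X a - X b‖ ≤ ‖X a - X b‖ * (R * |a - b|) := by
      have := mul_le_mul_of_nonneg_left h4 hR.le
      linarith
    exact le_of_mul_le_mul_left h5 h0

theorem lipschitzWith (hX : IsSupportCurve R K X) (hR : 0 < R) : LipschitzWith R.toNNReal X :=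
  LipschitzWith.of_dist_le_mul fun a b => by
    rw [dist_eq_norm, Real.dist_eq, Real.coe_toNNReal _ hR.le]
    exact hX.norm_sub_le hR a b

theorem continuous (hX : IsSupportCurve R K X) (hR : 0 < R) : Continuous X :=
  (hX.lipschitzWith hR).continuous

theorem inner_deriv_unitVec (hX : IsSupportCurve R K X) (θ : ℝ) :
    ⟪deriv X θ, unitVec θ⟫ = 0 := by
  by_cases hd : DifferentiableAt ℝ X θ
  · have hmax : IsLocalMax (fun φ => ⟪X φ, unitVec θ⟫) θ :=
      Eventually.of_forall fun φ => hX.support θ _ (hX.mem φ)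
    refine hmax.hasDerivAt_eq_zero ?_
    simpa using hd.hasDerivAt.inner ℝ (hasDerivAt_const θ (unitVec θ))
  · rw [deriv_zero_of_not_differentiableAt hd, inner_zero_left]

theorem deriv_eq (hX : IsSupportCurve R K X) (θ : ℝ) :
    deriv X θ = curvRadius X θ • tangentVec θ := by
  apply eq_of_inner_frame θ
  · rw [hX.inner_deriv_unitVec, real_inner_smul_left, inner_tangentVec_unitVec, sub_self,
      Real.sin_zero, mul_zero]
  · rw [real_inner_smul_left, inner_tangentVec_tangentVec, sub_self, Real.cos_zero, mul_one,
      curvRadius]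

theorem curvRadius_le (hX : IsSupportCurve R K X) (hR : 0 < R) (θ : ℝ) : curvRadius X θ ≤ R := by
  have h : ‖deriv X θ‖ ≤ R := by
    have := norm_deriv_le_of_lipschitz (hX.lipschitzWith hR) (x₀ := θ)
    rwa [Real.coe_toNNReal _ hR.le] at this
  refine (real_inner_le_norm _ _).trans ?_
  rwa [norm_tangentVec, mul_one]

/-- The normal map is monotone: `⟪X φ - X θ, unitVec φ - unitVec θ⟫` is nonnegative. Where `X` is
not differentiable, `deriv` is 0. -/
theorem curvRadius_nonneg (hX : IsSupportCurve R K X) (θ : ℝ) : 0 ≤ curvRadius X θ := by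
  by_cases hd : DifferentiableAt ℝ X θ
  · have h1 := hasDerivAt_iff_tendsto_slope.1 hd.hasDerivAt
    have h2 := hasDerivAt_iff_tendsto_slope.1 (hasDerivAt_unitVec θ)
    refine ge_of_tendsto (h1.inner (𝕜 := ℝ) h2) (Eventually.of_forall fun φ => ?_)
    simp only [slope_def_module]
    rw [real_inner_smul_left, real_inner_smul_right, inner_sub_right, inner_sub_left, inner_sub_left,
      ← mul_assoc]
    have e1 := hX.support θ _ (hX.mem φ)
    have e2 := hX.support φ _ (hX.mem θ)
    exact mul_nonneg (mul_self_nonneg _) (by linarith)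
  · rw [curvRadius, deriv_zero_of_not_differentiableAt hd, inner_zero_left]

end IsSupportCurve

theorem measurable_curvRadius (X : ℝ → Plane) : Measurable (curvRadius X) :=
  (measurable_deriv X).inner continuous_tangentVec.measurable

/-- A bounded measurable function is interval integrable. -/
theorem intervalIntegrable_of_bounded {f : ℝ → ℝ} {C : ℝ} (hf : Measurable f)
    (hC : ∀ x, |f x| ≤ C) (a b : ℝ) : IntervalIntegrable f volume a b := by
  rw [intervalIntegrable_iff]
  exact Measure.integrableOn_of_bounded (M := C) (by simp) hf.aestronglyMeasurable
    (Eventually.of_forall hC)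

namespace IsSupportCurve

variable {R : ℝ} {K : Set Plane} {X : ℝ → Plane}

theorem intervalIntegrable_curvRadius_mul (hX : IsSupportCurve R K X) (hR : 0 < R) {g : ℝ → ℝ}
    (hg : Continuous g) (a b : ℝ) :
    IntervalIntegrable (fun θ => curvRadius X θ * g θ) volume a b :=
  (intervalIntegrable_of_bounded (measurable_curvRadius X) (C := R) (fun x => by
    rw [abs_of_nonneg (hX.curvRadius_nonneg x)]; exact hX.curvRadius_le hR x) a b).mul_continuousOn
    hg.continuousOn

theorem intervalIntegrable_curvRadius (hX : IsSupportCurve R K X) (hR : 0 < R) (a b : ℝ) :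
    IntervalIntegrable (curvRadius X) volume a b := by
  simpa using hX.intervalIntegrable_curvRadius_mul hR (g := fun _ => 1) continuous_const a b

/-- Lipschitz functions are absolutely continuous, so the almost everywhere derivative recovers the
increments. -/
theorem inner_sub_eq_integral (hX : IsSupportCurve R K X) (hR : 0 < R) (w : Plane) (a b : ℝ) :
    ⟪X b - X a, w⟫ = ∫ t in a..b, curvRadius X t * ⟪tangentVec t, w⟫ := by
  have hlip : LipschitzWith (R.toNNReal * ‖w‖₊) (fun t => ⟪X t, w⟫) :=
    LipschitzWith.of_dist_le_mul fun s t => by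
      rw [Real.dist_eq, ← inner_sub_left, NNReal.coe_mul, mul_right_comm, coe_nnnorm]
      refine (abs_real_inner_le_norm _ _).trans ?_
      gcongr
      rw [← dist_eq_norm]
      exact (hX.lipschitzWith hR).dist_le_mul s t
  have h := (hlip.lipschitzOnWith (s := uIcc a b)).absolutelyContinuousOnInterval.integral_deriv_eq_sub
  rw [inner_sub_left, ← h]
  apply intervalIntegral.integral_congr_ae
  filter_upwards [(hX.lipschitzWith hR).ae_differentiableAt_real] with t ht _
  have h1 : HasDerivAt (fun s => ⟪X s, w⟫) ⟪deriv X t, w⟫ t := by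
    simpa using ht.hasDerivAt.inner ℝ (hasDerivAt_const t w)
  rw [h1.deriv, hX.deriv_eq, real_inner_smul_left]

theorem norm_sub_le_integral (hX : IsSupportCurve R K X) (hR : 0 < R) {a b : ℝ} (hab : a ≤ b) :
    ‖X b - X a‖ ≤ ∫ t in a..b, curvRadius X t := by
  have h := hX.inner_sub_eq_integral hR (X b - X a) a b
  rw [real_inner_self_eq_norm_sq] at h
  have h2 : ∫ t in a..b, curvRadius X t * ⟪tangentVec t, X b - X a⟫ ≤
      ∫ t in a..b, curvRadius X t * ‖X b - X a‖ := by
    refine intervalIntegral.integral_mono_on hab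
      (hX.intervalIntegrable_curvRadius_mul hR
        (continuous_tangentVec.inner continuous_const) a b)
      (hX.intervalIntegrable_curvRadius_mul hR continuous_const a b) fun t _ => ?_
    refine mul_le_mul_of_nonneg_left ?_ (hX.curvRadius_nonneg t)
    refine (real_inner_le_norm _ _).trans ?_
    rw [norm_tangentVec, one_mul]
  rw [intervalIntegral.integral_mul_const, ← h] at h2
  rcases (norm_nonneg (X b - X a)).eq_or_lt with h0 | h0
  · rw [← h0]
    exact intervalIntegral.integral_nonneg hab fun t _ => hX.curvRadius_nonneg t
  · exact le_of_mul_le_mul_right (by linarith [sq (‖X b - X a‖)]) h0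

/-- Over a short range of normals the tangent hardly turns, so the chord is almost as long as the
arc. -/
theorem cos_mul_integral_le (hX : IsSupportCurve R K X) (hR : 0 < R) {a b ε : ℝ} (hab : a ≤ b)
    (hb : b ≤ a + ε) (hε : ε ≤ π) :
    Real.cos ε * ∫ t in a..b, curvRadius X t ≤ ⟪X b - X a, tangentVec a⟫ := by
  rw [hX.inner_sub_eq_integral hR, mul_comm, ← intervalIntegral.integral_mul_const]
  refine intervalIntegral.integral_mono_on hab
    (hX.intervalIntegrable_curvRadius_mul hR continuous_const a b)
    (hX.intervalIntegrable_curvRadius_mul hR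
      (continuous_tangentVec.inner continuous_const) a b) fun t ht => ?_
  refine mul_le_mul_of_nonneg_left ?_ (hX.curvRadius_nonneg t)
  rw [inner_tangentVec_tangentVec]
  exact Real.cos_le_cos_of_nonneg_of_le_pi (by linarith [ht.1]) hε (by linarith [ht.2])

/-- Two equal points of the curve bound a constant piece of it. -/
theorem eq_of_eq (hX : IsSupportCurve R K X) (hR : 0 < R) {a b t : ℝ} (hab : b < a + π)
    (h : X a = X b) (ht : t ∈ Icc a b) : X t = X a := by
  rcases ht.1.eq_or_lt with h0 | h0
  · rw [h0]
  symm
  refine hX.eq_of_inner_eq hR t (hX.mem a) (le_antisymm (hX.support t _ (hX.mem a)) ?_)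
  have hs : 0 < Real.sin (b - a) :=
    Real.sin_pos_of_pos_of_lt_pi (by linarith [ht.2]) (by linarith)
  have h1 : 0 ≤ Real.sin (b - t) :=
    Real.sin_nonneg_of_nonneg_of_le_pi (by linarith [ht.2]) (by linarith [ht.1])
  have h2 : 0 ≤ Real.sin (t - a) :=
    Real.sin_nonneg_of_nonneg_of_le_pi (by linarith) (by linarith [ht.2])
  have e1 := hX.support a _ (hX.mem t)
  have e2 := hX.support b _ (hX.mem t)
  rw [← h] at e2
  refine le_of_mul_le_mul_left ?_ hs
  rw [sin_mul_inner_unitVec, sin_mul_inner_unitVec (X a)]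
  gcongr

theorem mem_frontier (hX : IsSupportCurve R K X) (θ : ℝ) : X θ ∈ frontier K :=
  mem_frontier_of_support (hX.mem θ) (hX.support θ)

/-- A boundary point has a supporting line; its outer normal has an angle in the given period, and
the support point there is unique. -/
theorem frontier_eq (hX : IsSupportCurve R K X) (hR : 0 < R) (hKc : IsClosed K)
    (hconv : Convex ℝ K) (hint : (interior K).Nonempty) (a : ℝ) :
    frontier K = X '' Ico a (a + 2 * π) := by
  refine Subset.antisymm (fun p hp => ?_) (image_subset_iff.2 fun θ _ => hX.mem_frontier θ)
  have hpK : p ∈ K := hKc.frontier_subset hp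
  obtain ⟨f, hf⟩ := geometric_hahn_banach_open_point hconv.interior isOpen_interior hp.2
  have hle : ∀ y ∈ K, f y ≤ f p := by
    have h1 : K ⊆ closure (interior K) := by
      rw [hconv.closure_interior_eq_closure_of_nonempty_interior hint]; exact subset_closure
    have h2 : closure (interior K) ⊆ {y | f y ≤ f p} :=
      closure_minimal (fun y hy => (hf y hy).le) (isClosed_le f.continuous continuous_const)
    exact fun y hy => h2 (h1 hy)
  set w := (InnerProductSpace.toDual ℝ Plane).symm f with hw
  have hfw : ∀ y, f y = ⟪y, w⟫ := fun y => by
    rw [real_inner_comm, hw, InnerProductSpace.toDual_symm_apply]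
  have hw0 : w ≠ 0 := by
    rintro h0
    obtain ⟨y, hy⟩ := hint
    have := hf y hy
    rw [hfw, hfw, h0, inner_zero_right, inner_zero_right] at this
    exact lt_irrefl _ this
  have hpos : 0 < ‖w‖ := norm_pos_iff.2 hw0
  obtain ⟨θ, hθ, hθw⟩ := exists_unitVec_eq (w := ‖w‖⁻¹ • w)
    (by rw [norm_smul, norm_inv, norm_norm, inv_mul_cancel₀ hpos.ne']) a
  refine ⟨θ, hθ, (hX.eq_of_inner_eq hR θ hpK (le_antisymm (hX.support θ _ hpK) ?_)).symm⟩
  rw [hθw, real_inner_smul_right, real_inner_smul_right, ← hfw, ← hfw]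
  exact mul_le_mul_of_nonneg_left (hle _ (hX.mem θ)) (by positivity)

end IsSupportCurve

/-! ### The perimeter as an integral of the radius of curvature. -/

/-- The hypothesis makes `g s ↦ f s` a well-defined 1-Lipschitz map from `g '' A` onto `f '' A`. -/
theorem hausdorffMeasure_image_le_of_dist_le {ι Y Z : Type*} [MetricSpace Y] [MeasurableSpace Y]
    [BorelSpace Y] [MetricSpace Z] [MeasurableSpace Z] [BorelSpace Z] {f : ι → Y} {g : ι → Z}
    {A : Set ι} (h : ∀ s ∈ A, ∀ t ∈ A, dist (f s) (f t) ≤ dist (g s) (g t)) {d : ℝ} (hd : 0 ≤ d) :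
    Measure.hausdorffMeasure d (f '' A) ≤ Measure.hausdorffMeasure d (g '' A) := by
  rcases A.eq_empty_or_nonempty with rfl | ⟨x, hx⟩
  · simp
  have : Nonempty ι := ⟨x⟩
  set T := Function.invFunOn g A with hT
  have hTmem : ∀ z ∈ g '' A, T z ∈ A := fun z hz => Function.invFunOn_mem hz
  have hTeq : ∀ z ∈ g '' A, g (T z) = z := fun z hz => Function.invFunOn_eq hz
  have hlip : LipschitzOnWith 1 (f ∘ T) (g '' A) := LipschitzOnWith.of_dist_le_mul
    fun z hz w hw => by
      have := h _ (hTmem z hz) _ (hTmem w hw)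
      rw [hTeq z hz, hTeq w hw] at this
      simpa using this
  have hsub : f '' A ⊆ (f ∘ T) '' (g '' A) := by
    rintro _ ⟨s, hs, rfl⟩
    have hgs : g s ∈ g '' A := mem_image_of_mem g hs
    refine ⟨g s, hgs, ?_⟩
    have := h _ (hTmem _ hgs) _ hs
    rw [hTeq _ hgs, dist_self] at this
    exact dist_le_zero.1 this
  calc _ ≤ _ := measure_mono hsub
    _ ≤ _ := hlip.hausdorffMeasure_image_le hd
    _ = _ := by simp

namespace IsSupportCurve

variable {R : ℝ} {K : Set Plane} {X : ℝ → Plane}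

theorem perimeter_le (hX : IsSupportCurve R K X) (hR : 0 < R) (hKc : IsClosed K)
    (hconv : Convex ℝ K) (hint : (interior K).Nonempty) (a : ℝ) :
    perimeter K ≤ ENNReal.ofReal (∫ t in a..a + 2 * π, curvRadius X t) := by
  rw [perimeter, hX.frontier_eq hR hKc hconv hint a]
  set S : ℝ → ℝ := fun θ => ∫ t in a..θ, curvRadius X t with hS
  have hsub : ∀ s t, S t - S s = ∫ x in s..t, curvRadius X x := fun s t =>
    intervalIntegral.integral_interval_sub_left (hX.intervalIntegrable_curvRadius hR _ _)
      (hX.intervalIntegrable_curvRadius hR _ _)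
  have hmono : Monotone S := fun s t hst => sub_nonneg.1 <| by
    rw [hsub]
    exact intervalIntegral.integral_nonneg hst fun x _ => hX.curvRadius_nonneg x
  have hd : ∀ s t, dist (X s) (X t) ≤ dist (S s) (S t) := by
    intro s t
    wlog hst : s ≤ t generalizing s t
    · rw [dist_comm, dist_comm (S s)]; exact this t s (le_of_not_ge hst)
    rw [dist_comm, dist_eq_norm, dist_comm, Real.dist_eq, abs_of_nonneg (sub_nonneg.2 (hmono hst)),
      hsub]
    exact hX.norm_sub_le_integral hR hst
  refine (hausdorffMeasure_image_le_of_dist_le (g := S) (fun s _ t _ => hd s t)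
    zero_le_one).trans ?_
  rw [hausdorffMeasure_real]
  have hsubset : S '' Ico a (a + 2 * π) ⊆ Icc 0 (S (a + 2 * π)) := by
    rintro _ ⟨s, hs, rfl⟩
    have h0 : S a = 0 := by simp [hS]
    exact ⟨h0 ▸ hmono hs.1, hmono hs.2.le⟩
  refine (measure_mono hsubset).trans ?_
  rw [Real.volume_Icc, sub_zero]

/-- Otherwise two opposite supporting lines share a point, and uniqueness of support points shrinks
`K` to that point. -/
theorem ne_add_pi (hX : IsSupportCurve R K X) (hR : 0 < R) (hint : (interior K).Nonempty) (s : ℝ) :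
    X s ≠ X (s + π) := by
  intro h
  have hsub : K ⊆ {X s} := fun y hy => by
    refine hX.eq_of_inner_eq hR s hy (le_antisymm (hX.support s y hy) ?_)
    have h1 := hX.support (s + π) y hy
    rw [← h, unitVec_add_pi, inner_neg_right, inner_neg_right] at h1
    linarith
  obtain ⟨y, hy⟩ := hint
  have := interior_mono hsub hy
  rw [interior_singleton] at this
  exact this

theorem ofReal_inner_le_hausdorffMeasure (hX : IsSupportCurve R K X) (hR : 0 < R) {a b : ℝ}
    (hab : a ≤ b) (c : ℝ) :
    ENNReal.ofReal ⟪X b - X a, tangentVec c⟫ ≤ Measure.hausdorffMeasure 1 (X '' Icc a b) := by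
  have h := hausdorffMeasure_image_le_of_dist_le (f := fun t => ⟪X t, tangentVec c⟫) (g := X)
    (A := Icc a b) (fun s _ t _ => by
      rw [Real.dist_eq, ← inner_sub_left, dist_eq_norm]
      refine (abs_real_inner_le_norm _ _).trans ?_
      rw [norm_tangentVec, mul_one]) zero_le_one
  refine le_trans ?_ h
  rw [hausdorffMeasure_real]
  have hc : ContinuousOn (fun t => ⟪X t, tangentVec c⟫) (Icc a b) := by
    have := hX.continuous hR
    fun_prop
  refine le_trans ?_ (measure_mono (intermediate_value_Icc hab hc))
  rw [Real.volume_Icc, inner_sub_left]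

/-- The boundary is cut into `N` pieces that overlap in null sets. Each is at least as long as its
projection to the tangent at its start. -/
theorem cos_mul_integral_le_perimeter (hX : IsSupportCurve R K X) (hR : 0 < R)
    (hint : (interior K).Nonempty) (a : ℝ) {N : ℕ} (hN : 2 ≤ N) :
    ENNReal.ofReal (Real.cos (2 * π / N) * ∫ t in a..a + 2 * π, curvRadius X t) ≤ perimeter K := by
  have hN0 : (0 : ℝ) < N := by positivity
  set ε := 2 * π / N with hε
  have hε0 : 0 < ε := by positivity
  have hεN : N * ε = 2 * π := by rw [hε]; field_simp
  set θ : ℕ → ℝ := fun i => a + i * ε with hθ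
  have hθs : ∀ i, θ (i + 1) = θ i + ε := fun i => by simp only [hθ]; push_cast; ring
  have hmono : Monotone θ := monotone_nat_of_le_succ fun i => by rw [hθs]; linarith
  have hθ0 : θ 0 = a := by simp [hθ]
  have hθN : θ N = a + 2 * π := by simp only [hθ, hεN]
  have hcont := hX.continuous hR
  have hdisj : ∀ i j, i < j → j < N →
      AEDisjoint (Measure.hausdorffMeasure 1) (X '' Icc (θ i) (θ (i + 1)))
        (X '' Icc (θ j) (θ (j + 1))) := by
    intro i j hij hjN
    have hsub : X '' Icc (θ i) (θ (i + 1)) ∩ X '' Icc (θ j) (θ (j + 1)) ⊆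
        {X (θ j), X (θ (j + 1))} := by
      rintro _ ⟨⟨s, hs, rfl⟩, ⟨t, ht, hts⟩⟩
      have hsj : s ≤ θ j := hs.2.trans (hmono hij)
      have hja : θ (j + 1) ≤ s + 2 * π := by
        have h1 := hmono (show j + 1 ≤ N from hjN)
        have h2 := hmono (Nat.zero_le i)
        rw [hθN] at h1
        rw [hθ0] at h2
        linarith [hs.1]
      -- Parameters of a common point bound a constant piece along whichever way round is shorter
      -- than `π`; that piece contains an endpoint of the `j`-th range.
      rcases lt_trichotomy t (s + π) with h | h | h
      · exact Or.inl (hX.eq_of_eq hR h hts.symm ⟨hsj, ht.1⟩).symm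
      · exact absurd (h ▸ hts.symm) (hX.ne_add_pi hR hint s)
      · refine Or.inr ?_
        have h1 : X t = X (s + 2 * π) := by rw [hX.periodic hR, hts]
        have h2 := hX.eq_of_eq hR (by linarith) h1 ⟨ht.2, hja⟩
        rw [mem_singleton_iff, h2, hts]
    have := Measure.nullSingletonClass_hausdorff Plane zero_lt_one
    exact measure_mono_null hsub ((toFinite _).measure_zero _)
  have hsum : ∑ i ∈ Finset.range N, Measure.hausdorffMeasure 1 (X '' Icc (θ i) (θ (i + 1))) ≤
      perimeter K := by
    rw [← measure_biUnion_finset₀]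
    · exact measure_mono (iUnion₂_subset fun i _ => image_subset_iff.2 fun t _ => hX.mem_frontier t)
    · intro i hi j hj hij
      rw [Finset.mem_coe, Finset.mem_range] at hi hj
      rcases lt_or_gt_of_ne hij with h | h
      · exact hdisj i j h hj
      · exact (hdisj j i h hi).symm
    · exact fun i _ => (isCompact_Icc.image hcont).measurableSet.nullMeasurableSet
  refine le_trans ?_ hsum
  have hεπ : ε ≤ π := by
    rw [hε, div_le_iff₀ hN0]
    have : (2 : ℝ) ≤ N := by exact_mod_cast hN
    nlinarith [Real.pi_pos]
  have h1 : Real.cos ε * ∫ t in a..a + 2 * π, curvRadius X t ≤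
      ∑ i ∈ Finset.range N, ⟪X (θ (i + 1)) - X (θ i), tangentVec (θ i)⟫ := by
    rw [← hθN, ← hθ0, ← intervalIntegral.sum_integral_adjacent_intervals
      (fun k _ => hX.intervalIntegrable_curvRadius hR _ _), Finset.mul_sum]
    exact Finset.sum_le_sum fun i _ => hX.cos_mul_integral_le hR (hmono (Nat.le_succ i))
      (hθs i).le hεπ
  refine (ENNReal.ofReal_le_ofReal h1).trans ((Finset.le_sum_of_subadditive _
    ENNReal.ofReal_zero.le (fun _ _ => ENNReal.ofReal_add_le) _ _).trans ?_)
  exact Finset.sum_le_sum fun i _ =>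
    hX.ofReal_inner_le_hausdorffMeasure hR (hmono (Nat.le_succ i)) _

/-- The perimeter is the integral of the radius of curvature over the normal angle. -/
theorem perimeter_eq (hX : IsSupportCurve R K X) (hR : 0 < R) (hKc : IsClosed K)
    (hconv : Convex ℝ K) (hint : (interior K).Nonempty) (a : ℝ) :
    perimeter K = ENNReal.ofReal (∫ t in a..a + 2 * π, curvRadius X t) := by
  refine le_antisymm (hX.perimeter_le hR hKc hconv hint a) ?_
  have hlim : Tendsto (fun N : ℕ => ENNReal.ofReal
      (Real.cos (2 * π / N) * ∫ t in a..a + 2 * π, curvRadius X t)) atTop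
      (𝓝 (ENNReal.ofReal (∫ t in a..a + 2 * π, curvRadius X t))) := by
    refine ENNReal.tendsto_ofReal ?_
    have h1 := (Real.continuous_cos.tendsto 0).comp (tendsto_const_div_atTop_nhds_zero_nat (2 * π))
    simpa using h1.mul_const (∫ t in a..a + 2 * π, curvRadius X t)
  refine le_of_tendsto hlim ?_
  filter_upwards [eventually_ge_atTop 2] with N hN
  exact hX.cos_mul_integral_le_perimeter hR hint a hN

end IsSupportCurve

/-! ### Densities bounded by one and their primitives. -/

/-- `S` is a primitive of a measurable density `ρ` with values in `[0, 1]`. -/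
structure IsUnitPrimitive (ρ S : ℝ → ℝ) : Prop where
  measurable : Measurable ρ
  nonneg : ∀ x, 0 ≤ ρ x
  le_one : ∀ x, ρ x ≤ 1
  sub_eq : ∀ s t, S t - S s = ∫ x in s..t, ρ x

namespace IsUnitPrimitive

variable {ρ S : ℝ → ℝ}

theorem intervalIntegrable (h : IsUnitPrimitive ρ S) (a b : ℝ) :
    IntervalIntegrable ρ volume a b :=
  intervalIntegrable_of_bounded h.measurable (C := 1)
    (fun x => by rw [abs_of_nonneg (h.nonneg x)]; exact h.le_one x) a b

theorem monotone (h : IsUnitPrimitive ρ S) : Monotone S := fun s t hst => sub_nonneg.1 <| by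
  rw [h.sub_eq]
  exact intervalIntegral.integral_nonneg hst fun x _ => h.nonneg x

theorem sub_le (h : IsUnitPrimitive ρ S) {s t : ℝ} (hst : s ≤ t) : S t - S s ≤ t - s := by
  rw [h.sub_eq]
  have := intervalIntegral.integral_mono_on hst (h.intervalIntegrable s t)
    (intervalIntegrable_const (c := (1 : ℝ))) fun x _ => h.le_one x
  simpa using this

theorem lipschitzWith (h : IsUnitPrimitive ρ S) : LipschitzWith 1 S :=
  LipschitzWith.of_dist_le_mul fun s t => by
    rw [NNReal.coe_one, one_mul]
    wlog hst : s ≤ t generalizing s t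
    · rw [dist_comm, dist_comm s]; exact this t s (le_of_not_ge hst)
    rw [dist_comm, dist_comm s, Real.dist_eq, Real.dist_eq,
      abs_of_nonneg (sub_nonneg.2 (h.monotone hst)), abs_of_nonneg (sub_nonneg.2 hst)]
    exact h.sub_le hst

theorem continuous (h : IsUnitPrimitive ρ S) : Continuous S := h.lipschitzWith.continuous

theorem ae_hasDerivAt (h : IsUnitPrimitive ρ S) : ∀ᵐ x, HasDerivAt S (ρ x) x := by
  have hloc : LocallyIntegrable ρ volume := by
    refine (locallyIntegrable_const (1 : ℝ)).mono h.measurable.aestronglyMeasurable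
      (Eventually.of_forall fun x => ?_)
    rw [Real.norm_of_nonneg (h.nonneg x), norm_one]
    exact h.le_one x
  filter_upwards [_root_.LocallyIntegrable.ae_hasDerivAt_integral hloc] with x hx
  refine ((hx 0).add_const (S 0)).congr_of_eventuallyEq (Eventually.of_forall fun y => ?_)
  simp only
  rw [← h.sub_eq]; ring

/-- Substitution `y = S x`. -/
theorem integral_comp_mul (h : IsUnitPrimitive ρ S) {F f : ℝ → ℝ}
    (hF : ∀ x, HasDerivAt F (f x) x) {C : NNReal} (hC : ∀ x, ‖f x‖₊ ≤ C) (s t : ℝ) :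
    ∫ x in s..t, f (S x) * ρ x = F (S t) - F (S s) := by
  have hFL : LipschitzWith C F := lipschitzWith_of_nnnorm_deriv_le
    (fun x => (hF x).differentiableAt) fun x => by rw [(hF x).deriv]; exact hC x
  have hac := ((hFL.comp h.lipschitzWith).lipschitzOnWith
    (s := uIcc s t)).absolutelyContinuousOnInterval.integral_deriv_eq_sub
  simp only [Function.comp_apply] at hac
  rw [← hac]
  apply intervalIntegral.integral_congr_ae
  filter_upwards [h.ae_hasDerivAt] with x hx _
  exact ((hF (S x)).comp x hx).deriv.symm

end IsUnitPrimitive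

/-! ### The chord inequality for the double sine integral. -/

/-- The part above the diagonal of a square. -/
def triangle (a b : ℝ) : Set (ℝ × ℝ) := {p | (p.1 ∈ Ioc a b ∧ p.2 ∈ Ioc a b) ∧ p.1 ≤ p.2}

theorem measurableSet_triangle (a b : ℝ) : MeasurableSet (triangle a b) :=
  ((measurable_fst measurableSet_Ioc).inter (measurable_snd measurableSet_Ioc)).inter
    (measurableSet_le measurable_fst measurable_snd)

theorem setIntegral_triangle {a b : ℝ} (hab : a ≤ b) {g : ℝ × ℝ → ℝ}
    (hg : IntegrableOn g (triangle a b)) :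
    ∫ p in triangle a b, g p = ∫ θ in a..b, ∫ t in a..θ, g (t, θ) := by
  rw [← integral_indicator (measurableSet_triangle a b), Measure.volume_eq_prod,
    integral_prod_symm _ (by
      rw [← Measure.volume_eq_prod]
      exact (integrable_indicator_iff (measurableSet_triangle a b)).2 hg),
    intervalIntegral.integral_of_le hab, ← integral_indicator measurableSet_Ioc]
  refine integral_congr_ae (Eventually.of_forall fun θ => ?_)
  simp only
  by_cases hθ : θ ∈ Ioc a b
  · rw [indicator_of_mem hθ, intervalIntegral.integral_of_le hθ.1.le,
      ← integral_indicator measurableSet_Ioc]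
    congr 1 with t
    by_cases ht : t ∈ Ioc a θ
    · rw [indicator_of_mem ht, indicator_of_mem]
      exact ⟨⟨⟨ht.1, ht.2.trans hθ.2⟩, hθ⟩, ht.2⟩
    · rw [indicator_of_notMem ht, indicator_of_notMem]
      exact fun h => ht ⟨h.1.1.1, h.2⟩
  · rw [indicator_of_notMem hθ]
    refine integral_eq_zero_of_ae (Eventually.of_forall fun t => ?_)
    exact indicator_of_notMem (fun h => hθ h.1.2) _

theorem setIntegral_triangle_swap {a b : ℝ} (hab : a ≤ b) {g : ℝ × ℝ → ℝ}
    (hg : IntegrableOn g (triangle a b)) :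
    ∫ p in triangle a b, g p = ∫ t in a..b, ∫ θ in t..b, g (t, θ) := by
  rw [← integral_indicator (measurableSet_triangle a b), Measure.volume_eq_prod,
    integral_prod _ (by
      rw [← Measure.volume_eq_prod]
      exact (integrable_indicator_iff (measurableSet_triangle a b)).2 hg),
    intervalIntegral.integral_of_le hab, ← integral_indicator measurableSet_Ioc]
  refine integral_congr_ae (Eventually.of_forall fun t => ?_)
  simp only
  by_cases ht : t ∈ Ioc a b
  · rw [indicator_of_mem ht, intervalIntegral.integral_of_le ht.2, ← integral_Icc_eq_integral_Ioc,
      ← integral_indicator measurableSet_Icc]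
    congr 1 with θ
    by_cases hθ : θ ∈ Icc t b
    · rw [indicator_of_mem hθ, indicator_of_mem]
      exact ⟨⟨ht, ⟨ht.1.trans_le hθ.1, hθ.2⟩⟩, hθ.1⟩
    · rw [indicator_of_notMem hθ, indicator_of_notMem]
      exact fun h => hθ ⟨h.2, h.1.2.2⟩
  · rw [indicator_of_notMem ht]
    refine integral_eq_zero_of_ae (Eventually.of_forall fun θ => ?_)
    exact indicator_of_notMem (fun h => ht h.1.1) _

theorem IsUnitPrimitive.integrableOn_triangle {ρ S : ℝ → ℝ} (h : IsUnitPrimitive ρ S)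
    {g : ℝ × ℝ → ℝ} (hg : Continuous g) (a b : ℝ) :
    IntegrableOn (fun p => g p * (ρ p.1 * ρ p.2)) (triangle a b) := by
  have h1 : IntegrableOn g (triangle a b) :=
    (hg.continuousOn.integrableOn_compact (isCompact_Icc.prod isCompact_Icc)).mono_set
      fun p hp => ⟨Ioc_subset_Icc_self hp.1.1, Ioc_subset_Icc_self hp.1.2⟩
  refine Integrable.mul_bdd (c := 1) h1 ?_ (Eventually.of_forall fun p => ?_)
  · exact ((h.measurable.comp measurable_fst).mul
      (h.measurable.comp measurable_snd)).aestronglyMeasurable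
  · rw [Real.norm_of_nonneg (mul_nonneg (h.nonneg _) (h.nonneg _))]
    exact mul_le_one₀ (h.le_one _) (h.nonneg _) (h.le_one _)

/-- Concavity of the sine on `[0, π]`: comparison of `sin g` with the chord over
`[δ, π - ℓ + δ]`. -/
theorem sin_ge_chord {ℓ δ g : ℝ} (hδ : 0 ≤ δ) (hδℓ : δ ≤ ℓ) (hg : δ ≤ g) (hg' : g ≤ π - ℓ + δ) :
    0 ≤ Real.sin g - Real.sin δ -
      (π - ℓ)⁻¹ * ((g - δ) * (Real.sin (ℓ - δ) - Real.sin δ)) := by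
  -- For `ℓ = π` the inverse is 0 by convention, and the interval degenerates to `g = δ`.
  rcases (show 0 ≤ π - ℓ by linarith).eq_or_lt with hc | hc
  · have : g = δ := by linarith
    rw [this]; simp
  · have hcv := strictConcaveOn_sin_Icc.concaveOn.2 (show δ ∈ Icc 0 π from ⟨hδ, by linarith⟩)
      (show π - ℓ + δ ∈ Icc 0 π from ⟨by linarith, by linarith⟩)
      (show 0 ≤ 1 - (π - ℓ)⁻¹ * (g - δ) by rw [sub_nonneg, inv_mul_le_iff₀ hc]; linarith)
      (show 0 ≤ (π - ℓ)⁻¹ * (g - δ) from mul_nonneg (inv_nonneg.2 hc.le) (by linarith)) (by ring)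
    simp only [smul_eq_mul] at hcv
    have e1 : (1 - (π - ℓ)⁻¹ * (g - δ)) * δ + (π - ℓ)⁻¹ * (g - δ) * (π - ℓ + δ) = g := by
      field_simp; ring
    have e2 : Real.sin (π - ℓ + δ) = Real.sin (ℓ - δ) := by
      rw [← Real.sin_pi_sub (ℓ - δ)]; congr 1; ring
    rw [e1, e2] at hcv
    linarith

theorem eq_of_sin_eq_chord {ℓ δ g : ℝ} (hδ : 0 ≤ δ) (hδℓ : δ ≤ ℓ) (hg : δ ≤ g)
    (hg' : g ≤ π - ℓ + δ) (hc : 0 < π - ℓ)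
    (h : Real.sin g - Real.sin δ -
      (π - ℓ)⁻¹ * ((g - δ) * (Real.sin (ℓ - δ) - Real.sin δ)) = 0) :
    g - δ = 0 ∨ g - δ = π - ℓ := by
  by_contra! hne
  have h1 : 0 < g - δ := lt_of_le_of_ne (by linarith) (Ne.symm hne.1)
  have h2 : g - δ < π - ℓ := lt_of_le_of_ne (by linarith) hne.2
  have hcv := strictConcaveOn_sin_Icc.2 (show δ ∈ Icc 0 π from ⟨hδ, by linarith⟩)
    (show π - ℓ + δ ∈ Icc 0 π from ⟨by linarith, by linarith⟩) (by linarith)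
    (show 0 < 1 - (π - ℓ)⁻¹ * (g - δ) by rw [sub_pos, inv_mul_lt_iff₀ hc]; linarith)
    (show 0 < (π - ℓ)⁻¹ * (g - δ) from mul_pos (inv_pos.2 hc) h1) (by ring)
  simp only [smul_eq_mul] at hcv
  have e1 : (1 - (π - ℓ)⁻¹ * (g - δ)) * δ + (π - ℓ)⁻¹ * (g - δ) * (π - ℓ + δ) = g := by
    field_simp; ring
  have e2 : Real.sin (π - ℓ + δ) = Real.sin (ℓ - δ) := by
    rw [← Real.sin_pi_sub (ℓ - δ)]; congr 1; ring
  rw [e1, e2] at hcv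
  linarith

namespace IsUnitPrimitive

variable {ρ S : ℝ → ℝ}

/-- The defect of the chord comparison at a pair of angles. -/
noncomputable def chordDefect (S : ℝ → ℝ) (ℓ : ℝ) (p : ℝ × ℝ) : ℝ :=
  Real.sin (p.2 - p.1) - Real.sin (S p.2 - S p.1) - (π - ℓ)⁻¹ *
    (((p.2 - p.1) - (S p.2 - S p.1)) *
      (Real.sin (ℓ - (S p.2 - S p.1)) - Real.sin (S p.2 - S p.1)))

theorem continuous_chordDefect (h : IsUnitPrimitive ρ S) (ℓ : ℝ) : Continuous (chordDefect S ℓ) := by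
  have := h.continuous
  unfold chordDefect
  fun_prop

/-- Both `S` and `x - S x` are monotone, so their increments between the two angles are at most
those over the whole half turn. -/
theorem bounds_of_mem_triangle (h : IsUnitPrimitive ρ S) {a : ℝ} {p : ℝ × ℝ}
    (hp : p ∈ triangle a (a + π)) :
    0 ≤ S p.2 - S p.1 ∧ S p.2 - S p.1 ≤ S (a + π) - S a ∧ S p.2 - S p.1 ≤ p.2 - p.1 ∧
      p.2 - p.1 ≤ π - (S (a + π) - S a) + (S p.2 - S p.1) := by
  obtain ⟨⟨⟨h1, h2⟩, ⟨h3, h4⟩⟩, h5⟩ := hp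
  have e1 := h.sub_le h1.le
  have e2 := h.sub_le h5
  have e3 := h.sub_le h4
  have m1 := h.monotone h1.le
  have m2 := h.monotone h5
  have m3 := h.monotone h4
  refine ⟨by linarith, by linarith, by linarith, by linarith⟩

/-- The integral of the chord defect. -/
theorem setIntegral_chordDefect (h : IsUnitPrimitive ρ S) (a : ℝ) :
    ∫ p in triangle a (a + π), chordDefect S (S (a + π) - S a) p * (ρ p.1 * ρ p.2) =
      (∫ θ in a..a + π, (∫ t in a..θ, Real.sin (θ - t) * ρ t) * ρ θ) -
        ((S (a + π) - S a) - Real.sin (S (a + π) - S a)) := by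
  have hcont := h.continuous
  set b := a + π with hb
  have hab : a ≤ b := by linarith [Real.pi_pos]
  set ℓ := S b - S a with hℓ
  set Ψ : ℝ → ℝ := fun δ => Real.sin (ℓ - δ) - Real.sin δ with hΨ
  -- The primitive of `Ψ` with `Φ 0 = 0`; it is symmetric under `δ ↦ ℓ - δ`.
  set Φ : ℝ → ℝ := fun δ => Real.cos (ℓ - δ) + Real.cos δ - Real.cos ℓ - 1 with hΦ
  have hΦd : ∀ δ, HasDerivAt Φ (Ψ δ) δ := fun δ => by
    have h1 := ((hasDerivAt_id δ).const_sub ℓ).cos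
    have h2 := (((h1.add (Real.hasDerivAt_cos δ)).sub_const (Real.cos ℓ)).sub_const 1)
    refine h2.congr_deriv ?_
    change -Real.sin (ℓ - δ) * -1 + -Real.sin δ = Real.sin (ℓ - δ) - Real.sin δ
    ring
  have hΨc : Continuous Ψ := by simp only [hΨ]; fun_prop
  have hΨb : ∀ δ, ‖Ψ δ‖₊ ≤ 2 := fun δ => by
    rw [← NNReal.coe_le_coe, coe_nnnorm]
    refine (norm_sub_le _ _).trans ?_
    have h1 := Real.abs_sin_le_one (ℓ - δ)
    have h2 := Real.abs_sin_le_one δ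
    rw [Real.norm_eq_abs, Real.norm_eq_abs]
    push_cast
    linarith
  have hinn : ∀ θ, ∫ t in a..θ, Ψ (S θ - S t) * ρ t = Φ (S θ - S a) := fun θ => by
    have h1 := h.integral_comp_mul (F := fun x => -Φ (S θ - x)) (f := fun x => Ψ (S θ - x))
      (fun x => by
        have := ((hΦd (S θ - x)).comp x ((hasDerivAt_id x).const_sub (S θ))).neg
        simpa [Function.comp_def] using! this) (C := 2) (fun x => hΨb _) a θ
    rw [h1]
    simp [hΦ]
  have hinn' : ∀ t, ∫ θ in t..b, Ψ (S θ - S t) * ρ θ = Φ (S b - S t) := fun t => by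
    have h1 := h.integral_comp_mul (F := fun x => Φ (x - S t)) (f := fun x => Ψ (x - S t))
      (fun x => by
        have := (hΦd (x - S t)).comp x ((hasDerivAt_id x).sub_const (S t))
        simpa [Function.comp_def] using! this) (C := 2) (fun x => hΨb _) t b
    rw [h1]
    simp [hΦ]
  have hsin : ∀ θ, ∫ t in a..θ, Real.sin (S θ - S t) * ρ t = 1 - Real.cos (S θ - S a) := fun θ => by
    have h1 := h.integral_comp_mul (F := fun x => Real.cos (S θ - x))
      (f := fun x => Real.sin (S θ - x)) (fun x => by
        simpa using ((hasDerivAt_id x).const_sub (S θ)).cos) (C := 1)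
      (fun x => by
        rw [← NNReal.coe_le_coe, coe_nnnorm]
        exact Real.abs_sin_le_one _) a θ
    rw [h1]
    simp
  have hsin' : ∫ θ in a..b, (1 - Real.cos (S θ - S a)) * ρ θ = ℓ - Real.sin ℓ := by
    have h1 := h.integral_comp_mul (F := fun x => x - Real.sin (x - S a))
      (f := fun x => 1 - Real.cos (x - S a)) (fun x => by
        simpa using! (hasDerivAt_id x).sub ((hasDerivAt_id x).sub_const (S a)).sin) (C := 2)
      (fun x => by
        rw [← NNReal.coe_le_coe, coe_nnnorm]
        have h1 := Real.neg_one_le_cos (x - S a)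
        have h2 := Real.cos_le_one (x - S a)
        rw [Real.norm_of_nonneg (by linarith)]
        push_cast
        linarith) a b
    rw [h1]
    simp [hℓ]; ring
  set g1 : ℝ × ℝ → ℝ := fun p => Real.sin (p.2 - p.1)
  set g2 : ℝ × ℝ → ℝ := fun p => Real.sin (S p.2 - S p.1)
  -- The excess is the difference of `x - S x` at the two angles. Integrating out the other angle in
  -- each piece, and using the symmetry of `Φ`, gives the same single integral twice.
  set g3 : ℝ × ℝ → ℝ := fun p => (p.2 - S p.2) * Ψ (S p.2 - S p.1)
  set g4 : ℝ × ℝ → ℝ := fun p => (p.1 - S p.1) * Ψ (S p.2 - S p.1)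
  have i1 := h.integrableOn_triangle (g := g1) (by fun_prop) a b
  have i2 := h.integrableOn_triangle (g := g2) (by fun_prop) a b
  have i3 := h.integrableOn_triangle (g := g3) (by fun_prop) a b
  have i4 := h.integrableOn_triangle (g := g4) (by fun_prop) a b
  have I1 : ∫ p in triangle a b, g1 p * (ρ p.1 * ρ p.2) =
      ∫ θ in a..b, (∫ t in a..θ, Real.sin (θ - t) * ρ t) * ρ θ := by
    rw [setIntegral_triangle hab i1]
    refine intervalIntegral.integral_congr fun θ _ => ?_
    simp only [g1, ← mul_assoc, intervalIntegral.integral_mul_const]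
  have I2 : ∫ p in triangle a b, g2 p * (ρ p.1 * ρ p.2) = ℓ - Real.sin ℓ := by
    rw [setIntegral_triangle hab i2, ← hsin']
    refine intervalIntegral.integral_congr fun θ _ => ?_
    simp only [g2, ← mul_assoc, intervalIntegral.integral_mul_const, hsin]
  have I3 : ∫ p in triangle a b, g3 p * (ρ p.1 * ρ p.2) =
      ∫ θ in a..b, (θ - S θ) * Φ (S θ - S a) * ρ θ := by
    rw [setIntegral_triangle hab i3]
    refine intervalIntegral.integral_congr fun θ _ => ?_
    simp only [g3, ← mul_assoc, intervalIntegral.integral_mul_const]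
    simp only [mul_assoc, intervalIntegral.integral_const_mul, hinn]
  have I4 : ∫ p in triangle a b, g4 p * (ρ p.1 * ρ p.2) =
      ∫ θ in a..b, (θ - S θ) * Φ (S θ - S a) * ρ θ := by
    rw [setIntegral_triangle_swap hab i4]
    refine intervalIntegral.integral_congr fun t _ => ?_
    have e : ∀ θ, g4 (t, θ) * (ρ t * ρ θ) = ((t - S t) * ρ t) * (Ψ (S θ - S t) * ρ θ) :=
      fun θ => by simp only [g4]; ring
    simp only [e, intervalIntegral.integral_const_mul, hinn']
    have e2 : Φ (S b - S t) = Φ (S t - S a) := by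
      simp only [hΦ, hℓ]
      rw [show S b - S a - (S b - S t) = S t - S a by ring,
        show S b - S a - (S t - S a) = S b - S t by ring]
      ring
    rw [e2]; ring
  have hsplit : ∀ p : ℝ × ℝ, chordDefect S ℓ p * (ρ p.1 * ρ p.2) =
      g1 p * (ρ p.1 * ρ p.2) - g2 p * (ρ p.1 * ρ p.2) -
        (π - ℓ)⁻¹ * (g3 p * (ρ p.1 * ρ p.2) - g4 p * (ρ p.1 * ρ p.2)) := fun p => by
    simp only [chordDefect, g1, g2, g3, g4, hΨ]; ring
  simp only [hsplit]
  have i12 : IntegrableOn (fun p => g1 p * (ρ p.1 * ρ p.2) - g2 p * (ρ p.1 * ρ p.2))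
    (triangle a b) := i1.sub i2
  have i34 : IntegrableOn (fun p => (π - ℓ)⁻¹ * (g3 p * (ρ p.1 * ρ p.2) -
    g4 p * (ρ p.1 * ρ p.2))) (triangle a b) := (i3.sub i4).const_mul _
  rw [integral_sub i12 i34, integral_sub i1 i2,
    integral_const_mul, integral_sub i3 i4, I1, I2, I3, I4]
  ring

theorem sub_sin_le_integral (h : IsUnitPrimitive ρ S) (a : ℝ) :
    (S (a + π) - S a) - Real.sin (S (a + π) - S a) ≤
      ∫ θ in a..a + π, (∫ t in a..θ, Real.sin (θ - t) * ρ t) * ρ θ := by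
  rw [← sub_nonneg, ← h.setIntegral_chordDefect a]
  refine setIntegral_nonneg (measurableSet_triangle _ _) fun p hp => ?_
  obtain ⟨h1, h2, h3, h4⟩ := h.bounds_of_mem_triangle hp
  exact mul_nonneg (sin_ge_chord h1 h2 h3 h4) (mul_nonneg (h.nonneg _) (h.nonneg _))

/-- The equality case: almost every pair of angles charged by `ρ` spans a full or an empty gap. -/
theorem ae_gap_of_eq (h : IsUnitPrimitive ρ S) {a : ℝ} (hc : S (a + π) - S a < π)
    (heq : ∫ θ in a..a + π, (∫ t in a..θ, Real.sin (θ - t) * ρ t) * ρ θ =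
      (S (a + π) - S a) - Real.sin (S (a + π) - S a)) :
    ∀ᵐ p : ℝ × ℝ, p ∈ triangle a (a + π) → ρ p.1 * ρ p.2 = 0 ∨
      (p.2 - p.1) - (S p.2 - S p.1) = 0 ∨
      (p.2 - p.1) - (S p.2 - S p.1) = π - (S (a + π) - S a) := by
  have h0 := h.setIntegral_chordDefect a
  rw [heq, sub_self, setIntegral_eq_zero_iff_of_nonneg_ae ?_
    (h.integrableOn_triangle (h.continuous_chordDefect _) _ _)] at h0
  · filter_upwards [(ae_restrict_iff' (measurableSet_triangle _ _)).1 h0] with p hp hpt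
    obtain ⟨h1, h2, h3, h4⟩ := h.bounds_of_mem_triangle hpt
    rcases mul_eq_zero.1 (hp hpt) with h5 | h5
    · exact Or.inr (eq_of_sin_eq_chord h1 h2 h3 h4 (by linarith) h5)
    · exact Or.inl h5
  · refine (ae_restrict_iff' (measurableSet_triangle _ _)).2 (Eventually.of_forall fun p hp => ?_)
    obtain ⟨h1, h2, h3, h4⟩ := h.bounds_of_mem_triangle hp
    exact mul_nonneg (sin_ge_chord h1 h2 h3 h4) (mul_nonneg (h.nonneg _) (h.nonneg _))

end IsUnitPrimitive

/-! ### Area in polar form about an interior point. -/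

/-- The area form of the plane. -/
def wedge (x y : Plane) : ℝ := x 0 * y 1 - x 1 * y 0

theorem wedge_smul_tangentVec (x : Plane) (r θ : ℝ) :
    wedge x (r • tangentVec θ) = ⟪x, unitVec θ⟫ * r := by
  simp [wedge, inner_plane]; ring

/-- The linear map with given columns. -/
noncomputable def columnMap (x y : Plane) : Plane →L[ℝ] Plane :=
  (EuclideanSpace.proj (0 : Fin 2) : Plane →L[ℝ] ℝ).smulRight x +
    (EuclideanSpace.proj (1 : Fin 2) : Plane →L[ℝ] ℝ).smulRight y

theorem det_columnMap (x y : Plane) : (columnMap x y).det = wedge x y := by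
  rw [ContinuousLinearMap.det,
    ← LinearMap.det_toMatrix (EuclideanSpace.basisFun (Fin 2) ℝ).toBasis, Matrix.det_fin_two]
  simp [LinearMap.toMatrix_apply, columnMap, wedge]
  ring

/-- Coordinates on the plane. -/
theorem measurePreserving_coord :
    MeasurePreserving (fun w : Plane => (w 0, w 1)) volume volume :=
  (volume_preserving_finTwoArrow ℝ).comp
    (EuclideanSpace.volume_preserving_symm_measurableEquiv_toLp (Fin 2))

/-- The cone map over a curve `X` with apex `p`. -/
noncomputable def coneMap (p : Plane) (X : ℝ → Plane) (w : Plane) : Plane :=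
  p + w 0 • (X (w 1) - p)

theorem hasFDerivAt_coneMap {p : Plane} {X : ℝ → Plane} {X' w : Plane}
    (hX : HasDerivAt X X' (w 1)) :
    HasFDerivAt (coneMap p X) (columnMap (X (w 1) - p) (w 0 • X')) w := by
  have h0 : HasFDerivAt (fun w : Plane => w 0) (EuclideanSpace.proj (0 : Fin 2) : Plane →L[ℝ] ℝ) w :=
    (EuclideanSpace.proj (0 : Fin 2) : Plane →L[ℝ] ℝ).hasFDerivAt
  have h1 : HasFDerivAt (fun w : Plane => w 1) (EuclideanSpace.proj (1 : Fin 2) : Plane →L[ℝ] ℝ) w :=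
    (EuclideanSpace.proj (1 : Fin 2) : Plane →L[ℝ] ℝ).hasFDerivAt
  have h2 : HasFDerivAt (fun w : Plane => X (w 1) - p)
      ((EuclideanSpace.proj (1 : Fin 2) : Plane →L[ℝ] ℝ).smulRight X') w :=
    (hX.hasFDerivAt.comp w h1 |>.congr_fderiv (by ext v; simp)).sub_const p
  refine ((h0.smul h2).const_add p).congr_fderiv ?_
  ext v
  simp [columnMap]
  ring

theorem lintegral_cone {G : Set ℝ} (hG : MeasurableSet G) {g : ℝ → ℝ} (hg : Measurable g)
    (hg0 : ∀ θ, 0 ≤ g θ) :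
    ∫⁻ w in {w : Plane | w 0 ∈ Ioc 0 1 ∧ w 1 ∈ G}, ENNReal.ofReal |w 0 * g (w 1)| =
      ENNReal.ofReal (1 / 2) * ∫⁻ θ in G, ENNReal.ofReal (g θ) := by
  have hpre : {w : Plane | w 0 ∈ Ioc 0 1 ∧ w 1 ∈ G} =
      (fun w : Plane => (w 0, w 1)) ⁻¹' (Ioc 0 1 ×ˢ G) := rfl
  have hf : Measurable fun q : ℝ × ℝ => ENNReal.ofReal |q.1 * g q.2| := by fun_prop
  rw [hpre, measurePreserving_coord.setLIntegral_comp_preimage (measurableSet_Ioc.prod hG)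
    (f := fun q : ℝ × ℝ => ENNReal.ofReal |q.1 * g q.2|) hf, Measure.volume_eq_prod,
    ← Measure.prod_restrict]
  have hcongr : ∀ᵐ q : ℝ × ℝ ∂((volume.restrict (Ioc (0 : ℝ) 1)).prod (volume.restrict G)),
      ENNReal.ofReal |q.1 * g q.2| = ENNReal.ofReal q.1 * ENNReal.ofReal (g q.2) := by
    rw [Measure.prod_restrict]
    refine (ae_restrict_iff' (measurableSet_Ioc.prod hG)).2 (Eventually.of_forall fun q hq => ?_)
    have h0 : 0 ≤ q.1 := hq.1.1.le
    rw [abs_of_nonneg (mul_nonneg h0 (hg0 _)), ENNReal.ofReal_mul h0]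
  rw [lintegral_congr_ae hcongr, lintegral_prod_mul (f := fun t : ℝ => ENNReal.ofReal t)
    (g := fun θ : ℝ => ENNReal.ofReal (g θ)) (by fun_prop) (by fun_prop)]
  congr 1
  rw [← ofReal_integral_eq_lintegral_ofReal]
  · rw [← intervalIntegral.integral_of_le zero_le_one, integral_id]; norm_num
  · exact (continuous_id.integrableOn_Icc (a := (0 : ℝ)) (b := 1)).mono_set Ioc_subset_Icc_self
  · exact (ae_restrict_iff' measurableSet_Ioc).2 (Eventually.of_forall fun t ht => ht.1.le)

theorem eq_zero_of_eventually_const {X : ℝ → Plane} {X' : Plane} {θ b : ℝ} (hb : θ < b)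
    (hX : HasDerivAt X X' θ) (h : ∀ t ∈ Icc θ b, X t = X θ) : X' = 0 := by
  have h1 : HasDerivWithinAt X X' (Icc θ b) θ := hX.hasDerivWithinAt
  have h2 : HasDerivWithinAt X 0 (Icc θ b) θ :=
    (hasDerivWithinAt_const θ _ (X θ)).congr h rfl
  exact (uniqueDiffOn_Icc hb θ ⟨le_rfl, hb.le⟩).eq_deriv _ h1 h2

namespace IsSupportCurve

variable {R : ℝ} {K : Set Plane} {X : ℝ → Plane}

theorem inner_sub_nonneg (hX : IsSupportCurve R K X) {p : Plane} (hp : p ∈ K) (θ : ℝ) :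
    0 ≤ ⟪X θ - p, unitVec θ⟫ := by
  rw [inner_sub_left]; linarith [hX.support θ p hp]

theorem eq_of_eq_of_curvRadius_pos (hX : IsSupportCurve R K X) (hR : 0 < R)
    (hint : (interior K).Nonempty) {s t : ℝ} (hst : s ≤ t) (ht : t < s + 2 * π)
    (hs : DifferentiableAt ℝ X s) (ht' : DifferentiableAt ℝ X t)
    (hρs : 0 < curvRadius X s) (hρt : 0 < curvRadius X t) (h : X s = X t) : s = t := by
  have hne : ∀ θ, 0 < curvRadius X θ → deriv X θ ≠ 0 := fun θ hθ h0 => by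
    rw [curvRadius, h0, inner_zero_left] at hθ; exact lt_irrefl _ hθ
  by_contra hne'
  have hlt : s < t := lt_of_le_of_ne hst hne'
  rcases lt_trichotomy t (s + π) with h1 | h1 | h1
  · exact hne s hρs (eq_zero_of_eventually_const hlt hs.hasDerivAt fun x hx =>
      hX.eq_of_eq hR h1 h hx)
  · exact hX.ne_add_pi hR hint s (h1 ▸ h)
  · refine hne t hρt (eq_zero_of_eventually_const ht ht'.hasDerivAt fun x hx =>
      hX.eq_of_eq hR (by linarith) ?_ hx)
    rw [hX.periodic hR, h]

/-- A point strictly inside a segment from the interior point `p` to `K` is interior, so a ray meets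
the boundary once. With positive curvature the boundary point determines its normal. -/
theorem injOn_coneMap (hX : IsSupportCurve R K X) (hR : 0 < R) (hconv : Convex ℝ K)
    {p : Plane} (hp : p ∈ interior K) (a : ℝ) :
    InjOn (coneMap p X) {w : Plane | w 0 ∈ Ioc 0 1 ∧ w 1 ∈ {θ | θ ∈ Ico a (a + 2 * π) ∧
      DifferentiableAt ℝ X θ ∧ 0 < curvRadius X θ}} := by
  have key : ∀ s t θ φ : ℝ, 0 < s → s < t → p + s • (X θ - p) ≠ p + t • (X φ - p) := by
    intro s t θ φ hs hst h
    have ht : 0 < t := hs.trans hst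
    have h1 : X φ = (1 - s / t) • p + (s / t) • X θ := by
      have h2 : s • (X θ - p) = t • (X φ - p) := add_left_cancel h
      have h3 : X φ - p = (s / t) • (X θ - p) := by
        rw [div_eq_inv_mul, mul_smul, h2, smul_smul, inv_mul_cancel₀ ht.ne', one_smul]
      rw [← sub_add_cancel (X φ) p, h3]; module
    have h4 : X φ ∈ interior K := by
      rw [h1]
      exact hconv.combo_interior_self_mem_interior hp (hX.mem θ)
        (sub_pos.2 ((div_lt_one ht).2 hst)) (by positivity) (by ring)
    exact (hX.mem_frontier φ).2 h4
  intro w hw z hz hwz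
  obtain ⟨⟨hw1, hw2⟩, hw3, hw4, hw5⟩ := hw
  obtain ⟨⟨hz1, hz2⟩, hz3, hz4, hz5⟩ := hz
  have e0 : w 0 = z 0 := by
    rcases lt_trichotomy (w 0) (z 0) with h | h | h
    · exact absurd hwz (key _ _ _ _ hw1 h)
    · exact h
    · exact absurd hwz.symm (key _ _ _ _ hz1 h)
  have hXX : X (w 1) = X (z 1) := by
    have h2 : w 0 • (X (w 1) - p) = z 0 • (X (z 1) - p) := add_left_cancel hwz
    rw [← e0] at h2
    exact sub_left_injective (smul_right_injective _ hw1.ne' h2)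
  refine plane_ext e0 ?_
  rcases le_total (w 1) (z 1) with h | h
  · exact hX.eq_of_eq_of_curvRadius_pos hR ⟨p, hp⟩ h (by linarith [hz3.2, hw3.1]) hw4 hz4 hw5 hz5 hXX
  · exact (hX.eq_of_eq_of_curvRadius_pos hR ⟨p, hp⟩ h (by linarith [hw3.2, hz3.1]) hz4 hw4 hz5 hw5
      hXX.symm).symm

theorem measurable_density (hX : IsSupportCurve R K X) (hR : 0 < R) (p : Plane) :
    Measurable fun θ => ⟪X θ - p, unitVec θ⟫ * curvRadius X θ := by
  have h1 : Continuous fun θ => ⟪X θ - p, unitVec θ⟫ :=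
    ((hX.continuous hR).sub continuous_const).inner continuous_unitVec
  exact h1.measurable.mul (measurable_curvRadius X)

theorem intervalIntegrable_density (hX : IsSupportCurve R K X) (hR : 0 < R) (p : Plane)
    (a b : ℝ) : IntervalIntegrable (fun θ => ⟪X θ - p, unitVec θ⟫ * curvRadius X θ) volume a b := by
  have h1 : Continuous fun θ => ⟪X θ - p, unitVec θ⟫ :=
    ((hX.continuous hR).sub continuous_const).inner continuous_unitVec
  simpa only [mul_comm] using hX.intervalIntegrable_curvRadius_mul hR h1 a b

theorem lintegral_density (hX : IsSupportCurve R K X) (hR : 0 < R) {p : Plane}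
    (hp : p ∈ K) (a : ℝ) :
    ENNReal.ofReal (1 / 2) * ∫⁻ θ in Ico a (a + 2 * π),
      ENNReal.ofReal (⟪X θ - p, unitVec θ⟫ * curvRadius X θ) =
    ENNReal.ofReal (1 / 2 * ∫ θ in a..a + 2 * π, ⟪X θ - p, unitVec θ⟫ * curvRadius X θ) := by
  have hle : a ≤ a + 2 * π := by linarith [Real.pi_pos]
  rw [ENNReal.ofReal_mul (by norm_num), intervalIntegral.integral_of_le hle,
    restrict_Ico_eq_restrict_Ioc, ofReal_integral_eq_lintegral_ofReal]
  · exact (intervalIntegrable_iff_integrableOn_Ioc_of_le hle).1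
      (hX.intervalIntegrable_density hR p _ _)
  · exact Eventually.of_forall fun θ => mul_nonneg (hX.inner_sub_nonneg hp θ)
      (hX.curvRadius_nonneg θ)

/-- Lower bound for the area by the integral of the support function. -/
theorem integral_le_volume (hX : IsSupportCurve R K X) (hR : 0 < R) (hconv : Convex ℝ K)
    {p : Plane} (hp : p ∈ interior K) (a : ℝ) :
    ENNReal.ofReal (1 / 2 * ∫ θ in a..a + 2 * π, ⟪X θ - p, unitVec θ⟫ * curvRadius X θ) ≤
      volume K := by
  have hpK := interior_subset hp
  -- The discarded parameters have zero density, including the nondifferentiable ones, where `deriv`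
  -- is 0. Removing them makes the cone map injective.
  set G : Set ℝ := {θ | θ ∈ Ico a (a + 2 * π) ∧ DifferentiableAt ℝ X θ ∧ 0 < curvRadius X θ}
    with hG
  have hGm : MeasurableSet G := measurableSet_Ico.inter ((measurableSet_of_differentiableAt ℝ X).inter
    (measurableSet_lt measurable_const (measurable_curvRadius X)))
  set D : Set Plane := {w : Plane | w 0 ∈ Ioc 0 1 ∧ w 1 ∈ G} with hD
  have hDm : MeasurableSet D :=
    measurePreserving_coord.measurable (measurableSet_Ioc.prod hGm)
  have hder : ∀ w ∈ D, HasFDerivWithinAt (coneMap p X)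
      (columnMap (X (w 1) - p) (w 0 • deriv X (w 1))) D w := fun w hw =>
    (hasFDerivAt_coneMap hw.2.2.1.hasDerivAt).hasFDerivWithinAt
  have hsub : coneMap p X '' D ⊆ K := by
    rintro _ ⟨w, hw, rfl⟩
    exact hconv.add_smul_sub_mem hpK (hX.mem _) ⟨hw.1.1.le, hw.1.2⟩
  refine le_trans ?_ (measure_mono hsub)
  rw [← lintegral_abs_det_fderiv_eq_addHaar_image volume hDm hder (hX.injOn_coneMap hR hconv hp a)]
  have hdet : ∀ w : Plane, (columnMap (X (w 1) - p) (w 0 • deriv X (w 1))).det =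
      w 0 * (⟪X (w 1) - p, unitVec (w 1)⟫ * curvRadius X (w 1)) := fun w => by
    rw [det_columnMap, hX.deriv_eq, smul_smul, wedge_smul_tangentVec]; ring
  simp only [hdet]
  rw [lintegral_cone hGm (hX.measurable_density hR p) (fun θ => mul_nonneg
    (hX.inner_sub_nonneg hpK θ) (hX.curvRadius_nonneg θ)), ← hX.lintegral_density hR hpK a]
  refine mul_le_mul_right ?_ _
  rw [← lintegral_indicator hGm, ← lintegral_indicator measurableSet_Ico]
  refine lintegral_mono fun θ => ?_
  by_cases h1 : θ ∈ G
  · rw [indicator_of_mem h1, indicator_of_mem h1.1]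
  · rw [indicator_of_notMem h1]
    by_cases h2 : θ ∈ Ico a (a + 2 * π)
    · rw [indicator_of_mem h2]
      have h3 : curvRadius X θ = 0 := by
        by_contra h3
        refine h1 ⟨h2, ?_, lt_of_le_of_ne (hX.curvRadius_nonneg θ) (Ne.symm h3)⟩
        by_contra h4
        exact h3 (by rw [curvRadius, deriv_zero_of_not_differentiableAt h4, inner_zero_left])
      rw [h3, mul_zero, ENNReal.ofReal_zero]
    · rw [indicator_of_notMem h2]

/-- Every point of a convex body lies on a segment from an interior point to the boundary. -/
theorem exists_cone_eq (hX : IsSupportCurve R K X) (hR : 0 < R) (hK : IsCompact K)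
    (hconv : Convex ℝ K) {p y : Plane} (hp : p ∈ interior K) (hy : y ∈ K) (hyp : y ≠ p) (a : ℝ) :
    ∃ t ∈ Ioc (0 : ℝ) 1, ∃ θ ∈ Ico a (a + 2 * π), y = p + t • (X θ - p) := by
  set f : ℝ → Plane := fun s => p + s • (y - p) with hf
  have hfc : Continuous f := by fun_prop
  have hpos : 0 < ‖y - p‖ := norm_pos_iff.2 (sub_ne_zero.2 hyp)
  obtain ⟨M, hM⟩ := hK.isBounded.subset_closedBall p
  have hbdd : f ⁻¹' K ⊆ Icc (-(M / ‖y - p‖)) (M / ‖y - p‖) := fun s hs => by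
    have h1 := mem_closedBall_iff_norm.1 (hM hs)
    rw [hf, add_sub_cancel_left, norm_smul, Real.norm_eq_abs] at h1
    exact abs_le.1 ((le_div_iff₀ hpos).2 h1)
  have hcomp : IsCompact (f ⁻¹' K) :=
    isCompact_Icc.of_isClosed_subset (hK.isClosed.preimage hfc) hbdd
  have h1mem : (1 : ℝ) ∈ f ⁻¹' K := by simp [hf, hy]
  obtain ⟨s, hs, hsmax⟩ := hcomp.exists_isGreatest ⟨1, h1mem⟩
  have hs1 : 1 ≤ s := hsmax h1mem
  have hfr : f s ∈ frontier K := by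
    refine ⟨subset_closure hs, fun hi => ?_⟩
    have hev : ∀ᶠ x in 𝓝[>] s, f x ∈ K :=
      ((hfc.tendsto s).mono_left nhdsWithin_le_nhds).eventually (mem_interior_iff_mem_nhds.1 hi)
    obtain ⟨x, hx1, hx2⟩ := (hev.and self_mem_nhdsWithin).exists
    exact absurd (hsmax hx1) (not_le.2 hx2)
  rw [hX.frontier_eq hR hK.isClosed hconv ⟨p, hp⟩ a] at hfr
  obtain ⟨θ, hθ, hθs⟩ := hfr
  have hs0 : 0 < s := by linarith
  refine ⟨s⁻¹, ⟨by positivity, inv_le_one_of_one_le₀ hs1⟩, θ, hθ, ?_⟩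
  rw [hθs, hf, add_sub_cancel_left, smul_smul, inv_mul_cancel₀ hs0.ne', one_smul,
    add_sub_cancel]

/-- Upper bound for the area by the integral of the support function, for boundary curves that are
differentiable outside a countable set. -/
theorem volume_le_integral (hX : IsSupportCurve R K X) (hR : 0 < R) (hK : IsCompact K)
    (hconv : Convex ℝ K) {p : Plane} (hp : p ∈ interior K) (a : ℝ) {C : Set ℝ} (hC : C.Countable)
    (hdiff : ∀ θ ∈ Ico a (a + 2 * π) \ C, DifferentiableAt ℝ X θ) :
    volume K ≤
      ENNReal.ofReal (1 / 2 * ∫ θ in a..a + 2 * π, ⟪X θ - p, unitVec θ⟫ * curvRadius X θ) := by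
  have hpK := interior_subset hp
  set G : Set ℝ := Ico a (a + 2 * π) \ C with hG
  have hGm : MeasurableSet G := measurableSet_Ico.diff hC.measurableSet
  set D : Set Plane := {w : Plane | w 0 ∈ Ioc 0 1 ∧ w 1 ∈ G} with hD
  have hDm : MeasurableSet D :=
    measurePreserving_coord.measurable (measurableSet_Ioc.prod hGm)
  have hder : ∀ w ∈ D, HasFDerivWithinAt (coneMap p X)
      (columnMap (X (w 1) - p) (w 0 • deriv X (w 1))) D w := fun w hw =>
    (hasFDerivAt_coneMap (hdiff _ hw.2).hasDerivAt).hasFDerivWithinAt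
  -- The cone map sends a line of fixed parameter affinely into a line, so countably many
  -- exceptional parameters cover no area.
  have hnull : ∀ θ ∈ C, volume (coneMap p X '' {w : Plane | w 1 = θ}) = 0 := fun θ _ => by
    refine addHaar_image_eq_zero_of_differentiableOn_of_addHaar_eq_zero volume ?_ ?_
    · have h1 : DifferentiableOn ℝ (fun w : Plane => p + w 0 • (X θ - p)) {w : Plane | w 1 = θ} := by
        fun_prop
      refine h1.congr fun w hw => ?_
      rw [coneMap, show w 1 = θ from hw]
    · have hpre : {w : Plane | w 1 = θ} = (fun w : Plane => (w 0, w 1)) ⁻¹' (univ ×ˢ {θ}) := by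
        ext w; simp
      rw [hpre, measurePreserving_coord.measure_preimage
        (MeasurableSet.univ.prod (measurableSet_singleton θ)).nullMeasurableSet,
        Measure.volume_eq_prod, Measure.prod_prod, Real.volume_singleton, mul_zero]
  have hcover : K ⊆ ({p} ∪ ⋃ θ ∈ C, coneMap p X '' {w : Plane | w 1 = θ}) ∪ coneMap p X '' D := by
    intro y hy
    by_cases hyp : y = p
    · exact Or.inl (Or.inl hyp)
    obtain ⟨t, ht, θ, hθ, hyt⟩ := hX.exists_cone_eq hR hK hconv hp hy hyp a
    have he : coneMap p X !₂[t, θ] = y := by rw [hyt]; simp [coneMap]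
    by_cases hθC : θ ∈ C
    · exact Or.inl (Or.inr (mem_iUnion₂.2 ⟨θ, hθC, !₂[t, θ], by simp, he⟩))
    · exact Or.inr ⟨!₂[t, θ], ⟨by simpa using ht, by simpa using ⟨hθ, hθC⟩⟩, he⟩
  have hzero : volume ({p} ∪ ⋃ θ ∈ C, coneMap p X '' {w : Plane | w 1 = θ}) = 0 :=
    measure_union_null (measure_singleton p) ((measure_biUnion_null_iff hC).2 hnull)
  refine (measure_mono hcover).trans ((measure_union_le _ _).trans ?_)
  rw [hzero, zero_add]
  refine (addHaar_image_le_lintegral_abs_det_fderiv volume hDm hder).trans ?_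
  have hdet : ∀ w : Plane, (columnMap (X (w 1) - p) (w 0 • deriv X (w 1))).det =
      w 0 * (⟪X (w 1) - p, unitVec (w 1)⟫ * curvRadius X (w 1)) := fun w => by
    rw [det_columnMap, hX.deriv_eq, smul_smul, wedge_smul_tangentVec]; ring
  simp only [hdet]
  rw [lintegral_cone hGm (hX.measurable_density hR p) (fun θ => mul_nonneg
    (hX.inner_sub_nonneg hpK θ) (hX.curvRadius_nonneg θ)), ← hX.lintegral_density hR hpK a]
  gcongr
  exact sdiff_subset

end IsSupportCurve

/-! ### Splitting the area integral along a chord. -/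

/-- The primitive of the normalized radius of curvature. -/
noncomputable def turnLength (R : ℝ) (X : ℝ → Plane) (θ : ℝ) : ℝ := ∫ t in 0..θ, curvRadius X t / R

namespace IsSupportCurve

variable {R : ℝ} {K : Set Plane} {X : ℝ → Plane}

theorem isUnitPrimitive (hX : IsSupportCurve R K X) (hR : 0 < R) :
    IsUnitPrimitive (fun θ => curvRadius X θ / R) (turnLength R X) where
  measurable := (measurable_curvRadius X).div_const R
  nonneg θ := div_nonneg (hX.curvRadius_nonneg θ) hR.le
  le_one θ := (div_le_one hR).2 (hX.curvRadius_le hR θ)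
  sub_eq _ _ := intervalIntegral.integral_interval_sub_left
    ((hX.intervalIntegrable_curvRadius hR _ _).div_const R)
    ((hX.intervalIntegrable_curvRadius hR _ _).div_const R)

theorem integral_curvRadius (hX : IsSupportCurve R K X) (hR : 0 < R) (a b : ℝ) :
    ∫ t in a..b, curvRadius X t = R * (turnLength R X b - turnLength R X a) := by
  rw [(hX.isUnitPrimitive hR).sub_eq, intervalIntegral.integral_div]
  field_simp

/-- The area form with `w` is the inner product with `w` turned by a right angle. -/
theorem integral_inner_unitVec (hX : IsSupportCurve R K X) (hR : 0 < R) (w : Plane) (a b : ℝ) :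
    ∫ θ in a..b, ⟪w, unitVec θ⟫ * curvRadius X θ = wedge w (X b - X a) := by
  have h := hX.inner_sub_eq_integral hR !₂[-w 1, w 0] a b
  have e : wedge w (X b - X a) = ⟪X b - X a, !₂[-w 1, w 0]⟫ := by
    simp [wedge, inner_plane]; ring
  rw [e, h]
  refine intervalIntegral.integral_congr fun θ _ => ?_
  simp [inner_plane]; ring

/-- Splitting `X θ - p` at `X a` leaves a double integral over normals and a term depending only on
the chord. -/
theorem integral_half (hX : IsSupportCurve R K X) (hR : 0 < R) (p : Plane) (a b : ℝ) :
    ∫ θ in a..b, ⟪X θ - p, unitVec θ⟫ * curvRadius X θ =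
      R ^ 2 * (∫ θ in a..b, (∫ t in a..θ, Real.sin (θ - t) * (curvRadius X t / R)) *
        (curvRadius X θ / R)) + wedge (X a - p) (X b - X a) := by
  rw [← hX.integral_inner_unitVec hR, ← intervalIntegral.integral_const_mul]
  have h1 : ∀ θ, R ^ 2 * ((∫ t in a..θ, Real.sin (θ - t) * (curvRadius X t / R)) *
      (curvRadius X θ / R)) = ⟪X θ - X a, unitVec θ⟫ * curvRadius X θ := fun θ => by
    rw [hX.inner_sub_eq_integral hR]
    have h2 : ∀ t, Real.sin (θ - t) * (curvRadius X t / R) =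
        curvRadius X t * ⟪tangentVec t, unitVec θ⟫ / R := fun t => by
      rw [inner_tangentVec_unitVec]; ring
    simp only [h2, intervalIntegral.integral_div]
    field_simp
  simp only [h1]
  rw [← intervalIntegral.integral_add (hX.intervalIntegrable_density hR _ _ _)]
  · refine intervalIntegral.integral_congr fun θ _ => ?_
    simp only [inner_sub_left]; ring
  · simpa only [mul_comm] using hX.intervalIntegrable_curvRadius_mul hR
      (g := fun θ => ⟪X a - p, unitVec θ⟫) (continuous_const.inner continuous_unitVec) a b

/-- The two halves cut off by a chord with parallel supporting lines. -/
theorem integral_eq_halves (hX : IsSupportCurve R K X) (hR : 0 < R) (p : Plane) (a : ℝ) :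
    ∫ θ in a..a + 2 * π, ⟪X θ - p, unitVec θ⟫ * curvRadius X θ =
      R ^ 2 * ((∫ θ in a..a + π, (∫ t in a..θ, Real.sin (θ - t) * (curvRadius X t / R)) *
        (curvRadius X θ / R)) + ∫ θ in a + π..a + π + π, (∫ t in a + π..θ,
          Real.sin (θ - t) * (curvRadius X t / R)) * (curvRadius X θ / R)) := by
  rw [← intervalIntegral.integral_add_adjacent_intervals
    (hX.intervalIntegrable_density hR p a (a + π)) (hX.intervalIntegrable_density hR p _ _),
    hX.integral_half hR p, show a + 2 * π = a + π + π by ring, hX.integral_half hR p (a + π)]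
  have hper : X (a + π + π) = X a := by
    rw [show a + π + π = a + 2 * π by ring, hX.periodic hR]
  rw [hper]
  -- The second chord is the first reversed, so the two area terms add up to the area form of
  -- parallel vectors.
  simp only [wedge, PiLp.sub_apply]
  ring

end IsSupportCurve

/-! ### The lower bound for the area and its equality case. -/

/-- Convexity of `x - sin x`. -/
theorem two_mul_sub_sin_le {x y : ℝ} (hx : 0 ≤ x) (hy : 0 ≤ y) (hx' : x ≤ π) (hy' : y ≤ π) :
    2 * ((x + y) / 2 - Real.sin ((x + y) / 2)) ≤ (x - Real.sin x) + (y - Real.sin y) := by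
  have h := strictConcaveOn_sin_Icc.concaveOn.2 (show x ∈ Icc 0 π from ⟨hx, hx'⟩)
    (show y ∈ Icc 0 π from ⟨hy, hy'⟩) (show (0 : ℝ) ≤ 1 / 2 by norm_num)
    (show (0 : ℝ) ≤ 1 / 2 by norm_num) (by norm_num)
  simp only [smul_eq_mul] at h
  rw [show 1 / 2 * x + 1 / 2 * y = (x + y) / 2 by ring] at h
  linarith

theorem eq_of_sub_sin_le {x y : ℝ} (hx : 0 ≤ x) (hy : 0 ≤ y) (hx' : x ≤ π) (hy' : y ≤ π)
    (hle : (x - Real.sin x) + (y - Real.sin y) ≤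
      2 * ((x + y) / 2 - Real.sin ((x + y) / 2))) : x = y := by
  by_contra hne
  have h := strictConcaveOn_sin_Icc.2 (show x ∈ Icc 0 π from ⟨hx, hx'⟩)
    (show y ∈ Icc 0 π from ⟨hy, hy'⟩) hne (show (0 : ℝ) < 1 / 2 by norm_num)
    (show (0 : ℝ) < 1 / 2 by norm_num) (by norm_num)
  simp only [smul_eq_mul] at h
  rw [show 1 / 2 * x + 1 / 2 * y = (x + y) / 2 by ring] at h
  linarith

namespace IsUnitPrimitive

variable {ρ S : ℝ → ℝ}

theorem half_bounds (h : IsUnitPrimitive ρ S) (a : ℝ) :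
    0 ≤ S (a + π) - S a ∧ S (a + π) - S a ≤ π := by
  have hle : a ≤ a + π := by linarith [Real.pi_pos]
  have h1 := h.sub_le hle
  exact ⟨sub_nonneg.2 (h.monotone hle), by linarith⟩

/-- In the equality case the density vanishes on an interval of length `π - m`. -/
theorem exists_gap (h : IsUnitPrimitive ρ S) {m : ℝ} (hm0 : 0 < m) (hmπ : m < π)
    (hhalf : ∀ a, S (a + π) - S a = m)
    (heq : ∫ θ in (0 : ℝ)..0 + π, (∫ t in (0 : ℝ)..θ, Real.sin (θ - t) * ρ t) * ρ θ =
      m - Real.sin m) :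
    ∃ α, S (α + (π - m)) = S α := by
  have hc : Continuous S := h.continuous
  have hgap := h.ae_gap_of_eq (a := 0) (by rw [hhalf]; exact hmπ) (by rw [hhalf]; exact heq)
  rw [hhalf, zero_add] at hgap
  rw [Measure.volume_eq_prod] at hgap
  have hgap1 := Measure.ae_ae_of_ae_prod hgap
  -- The gap condition is needed with the fixed angle as either the smaller or the larger of the
  -- pair.
  have hswap : ∀ᵐ p : ℝ × ℝ ∂(volume.prod volume), p.swap ∈ triangle 0 π →
      ρ p.2 * ρ p.1 = 0 ∨ (p.1 - p.2) - (S p.1 - S p.2) = 0 ∨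
      (p.1 - p.2) - (S p.1 - S p.2) = π - m :=
    (Measure.measurePreserving_swap (μ := (volume : Measure ℝ))
      (ν := (volume : Measure ℝ))).quasiMeasurePreserving.ae hgap
  have hgap2 := Measure.ae_ae_of_ae_prod hswap
  have hper : ∀ᵐ x, ρ (x - π) = ρ x := by
    have h1 := h.ae_hasDerivAt
    have h2 : ∀ᵐ x, HasDerivAt S (ρ (x - π)) (x - π) :=
      (measurePreserving_sub_right volume π).quasiMeasurePreserving.ae h1
    filter_upwards [h1, h2] with x hx1 hx2
    have h3 : HasDerivAt (fun y => S (y - π) + m) (ρ (x - π)) x := by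
      simpa using (hx2.comp x ((hasDerivAt_id x).sub_const π)).add_const m
    have h4 : (fun y => S (y - π) + m) = S := by
      funext y
      have := hhalf (y - π)
      rw [sub_add_cancel] at this
      linarith
    rw [h4] at h3
    exact h3.unique hx1
  -- A charged angle with both slice conditions exists, as otherwise `ρ` would have integral 0
  -- instead of `m`.
  obtain ⟨t, ht, htρ, hg1, hg2⟩ : ∃ t ∈ Ioc 0 π, ρ t ≠ 0 ∧
      (∀ᵐ θ, (t, θ) ∈ triangle 0 π → ρ t * ρ θ = 0 ∨ (θ - t) - (S θ - S t) = 0 ∨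
        (θ - t) - (S θ - S t) = π - m) ∧
      (∀ᵐ θ, (θ, t) ∈ triangle 0 π → ρ θ * ρ t = 0 ∨ (t - θ) - (S t - S θ) = 0 ∨
        (t - θ) - (S t - S θ) = π - m) := by
    by_contra hcon
    have hz : ∫ x in (0 : ℝ)..π, ρ x = ∫ _x in (0 : ℝ)..π, (0 : ℝ) := by
      apply intervalIntegral.integral_congr_ae
      filter_upwards [hgap1, hgap2] with x hx1 hx2 hx
      rw [uIoc_of_le Real.pi_pos.le] at hx
      by_contra hρ
      exact hcon ⟨x, hx, hρ, hx1, hx2⟩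
    have := hhalf 0
    rw [zero_add, h.sub_eq, hz, intervalIntegral.integral_zero] at this
    linarith
  set z : ℝ → ℝ := fun θ => θ - S θ with hz
  have hzc : Continuous z := by simp only [hz]; fun_prop
  have hzm : Monotone z := fun x y hxy => by
    have := h.sub_le hxy
    simp only [hz]; linarith
  have hzπ : ∀ x, z (x + π) = z x + (π - m) := fun x => by
    have := hhalf x
    simp only [hz]; linarith
  -- Angles beyond `π` are shifted back by `π`; since `z` gains `π - m` there, the two levels are
  -- exchanged.
  have hae : ∀ᵐ θ, θ ∈ Ioc t (t + π) → ρ θ = 0 ∨ z θ = z t ∨ z θ = z t + (π - m) := by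
    have hg2' : ∀ᵐ θ, (θ - π, t) ∈ triangle 0 π → ρ (θ - π) * ρ t = 0 ∨
        (t - (θ - π)) - (S t - S (θ - π)) = 0 ∨ (t - (θ - π)) - (S t - S (θ - π)) = π - m :=
      (measurePreserving_sub_right volume π).quasiMeasurePreserving.ae hg2
    filter_upwards [hg1, hg2', hper] with θ h1 h2 h3 hθ
    rcases le_or_gt θ π with hle | hgt
    · rcases h1 ⟨⟨ht, ⟨ht.1.trans hθ.1, hle⟩⟩, hθ.1.le⟩ with h4 | h4 | h4
      · exact Or.inl ((mul_eq_zero.1 h4).resolve_left htρ)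
      · refine Or.inr (Or.inl ?_); simp only [hz]; linarith
      · refine Or.inr (Or.inr ?_); simp only [hz]; linarith
    · have h5 := hhalf (θ - π)
      rw [sub_add_cancel] at h5
      rcases h2 ⟨⟨⟨by simpa using hgt, by linarith [hθ.2, ht.2]⟩, ht⟩,
        by simpa using (show θ - π ≤ t by linarith [hθ.2])⟩ with h4 | h4 | h4
      · rw [h3] at h4
        exact Or.inl ((mul_eq_zero.1 h4).resolve_right htρ)
      · refine Or.inr (Or.inr ?_); simp only [hz]; linarith
      · refine Or.inr (Or.inl ?_); simp only [hz]; linarith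
  have htπ : t ≤ t + π := by linarith [Real.pi_pos]
  -- `α` is the last angle at the lower level of `z` and `β` the first at the upper one. Between
  -- them `ρ` vanishes, so `z` has slope 1 and `β - α = π - m`.
  obtain ⟨α, hα, hαmax⟩ := (isCompact_Icc.inter_right
    (isClosed_le hzc continuous_const)).exists_isGreatest
    (⟨t, ⟨le_rfl, htπ⟩, le_refl (z t)⟩ : (Icc t (t + π) ∩ {x | z x ≤ z t}).Nonempty)
  obtain ⟨β, hβ, hβmin⟩ := (isCompact_Icc.inter_right
    (isClosed_le continuous_const hzc)).exists_isLeast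
    (⟨t + π, ⟨htπ, le_rfl⟩, (hzπ t).ge⟩ :
      (Icc t (t + π) ∩ {x | z t + (π - m) ≤ z x}).Nonempty)
  have hzα : z α = z t := le_antisymm hα.2 (hzm hα.1.1)
  have hzβ : z β = z t + (π - m) := le_antisymm ((hzm hβ.1.2).trans (hzπ t).le) hβ.2
  have hαβ : α < β := by
    by_contra! hle
    have := hzm hle
    rw [hzα, hzβ] at this
    linarith
  have hS : S β - S α = 0 := by
    rw [h.sub_eq]
    have : ∫ x in α..β, ρ x = ∫ _x in α..β, (0 : ℝ) := by
      apply intervalIntegral.integral_congr_ae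
      have hne : ∀ᵐ x, x ≠ β := by simp [ae_iff, measure_singleton]
      filter_upwards [hae, hne] with x hx hxβ hxm
      rw [uIoc_of_le hαβ.le] at hxm
      have hxI : x ∈ Icc t (t + π) := ⟨hα.1.1.trans hxm.1.le, hxm.2.trans hβ.1.2⟩
      rcases hx ⟨hα.1.1.trans_lt hxm.1, hxI.2⟩ with h1 | h1 | h1
      · exact h1
      · exact absurd (hαmax ⟨hxI, h1.le⟩) (not_le.2 hxm.1)
      · exact absurd (hβmin ⟨hxI, h1.ge⟩) (not_le.2 (lt_of_le_of_ne hxm.2 hxβ))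
    rw [this, intervalIntegral.integral_zero]
  refine ⟨α, ?_⟩
  have hβα : α + (π - m) = β := by
    simp only [hz] at hzα hzβ
    linarith
  rw [hβα]; linarith

end IsUnitPrimitive

namespace IsSupportCurve

variable {R : ℝ} {K : Set Plane} {X : ℝ → Plane}

/-- Where the radius of curvature is maximal, the curve is an arc of a circle. -/
theorem center_eq_of_full (hX : IsSupportCurve R K X) (hR : 0 < R) {a b : ℝ} (hab : a ≤ b)
    (h : turnLength R X b - turnLength R X a = b - a) :
    X b - R • unitVec b = X a - R • unitVec a := by
  have hi := hX.intervalIntegrable_curvRadius hR a b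
  have h0 : ∫ t in a..b, (R - curvRadius X t) = 0 := by
    rw [intervalIntegral.integral_sub intervalIntegrable_const hi, hX.integral_curvRadius hR, h,
      intervalIntegral.integral_const, smul_eq_mul]
    ring
  rw [intervalIntegral.integral_eq_zero_iff_of_le_of_nonneg_ae hab
    (Eventually.of_forall fun t => sub_nonneg.2 (hX.curvRadius_le hR t))
    (intervalIntegrable_const.sub hi)] at h0
  have h0' := (ae_restrict_iff' measurableSet_Ioc).1 h0
  -- At full curvature `X` and `R • unitVec` have equal increments; the displacement of the centre
  -- is tested against itself.
  set d := (X b - R • unitVec b) - (X a - R • unitVec a) with hd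
  have h1 := hX.inner_sub_eq_integral hR d a b
  have h2 : ∫ t in a..b, curvRadius X t * ⟪tangentVec t, d⟫ =
      ∫ t in a..b, R * ⟪d, tangentVec t⟫ := by
    apply intervalIntegral.integral_congr_ae
    filter_upwards [h0'] with t ht htab
    rw [uIoc_of_le hab] at htab
    have h3 : R - curvRadius X t = 0 := ht htab
    rw [real_inner_comm d, sub_eq_zero.1 h3]
  have h3 : ∫ t in a..b, R * ⟪d, tangentVec t⟫ = R * (⟪d, unitVec b⟫ - ⟪d, unitVec a⟫) := by
    rw [intervalIntegral.integral_const_mul,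
      intervalIntegral.integral_eq_sub_of_hasDerivAt (fun t _ => hasDerivAt_inner_unitVec d t)
      ((continuous_const.inner continuous_tangentVec).intervalIntegrable _ _)]
  rw [h2, h3] at h1
  have h4 : ⟪d, d⟫ = 0 := by
    nth_rewrite 1 [hd]
    rw [show X b - R • unitVec b - (X a - R • unitVec a) =
      (X b - X a) - (R • unitVec b - R • unitVec a) by abel, inner_sub_left, h1,
      inner_sub_left (R • unitVec b), real_inner_smul_left, real_inner_smul_left,
      real_inner_comm d (unitVec a), real_inner_comm d (unitVec b)]
    ring
  exact sub_eq_zero.1 (inner_self_eq_zero.1 h4)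

/-- A closed convex set is the intersection of its supporting half-planes. -/
theorem mem_of_forall_inner_le (hX : IsSupportCurve R K X) (hK : IsClosed K) (hconv : Convex ℝ K)
    {y : Plane} (a : ℝ) (h : ∀ θ ∈ Ico a (a + 2 * π), ⟪y, unitVec θ⟫ ≤ ⟪X θ, unitVec θ⟫) :
    y ∈ K := by
  by_contra hy
  obtain ⟨f, r, hf, hr⟩ := geometric_hahn_banach_closed_point hconv hK hy
  set w := (InnerProductSpace.toDual ℝ Plane).symm f with hw
  have hfw : ∀ y, f y = ⟪y, w⟫ := fun y => by
    rw [real_inner_comm, hw, InnerProductSpace.toDual_symm_apply]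
  have hw0 : w ≠ 0 := by
    rintro h0
    have h1 := (hf _ (hX.mem 0)).trans hr
    rw [hfw, hfw, h0, inner_zero_right, inner_zero_right] at h1
    exact lt_irrefl _ h1
  have hpos : 0 < ‖w‖ := norm_pos_iff.2 hw0
  obtain ⟨θ, hθ, hθw⟩ := exists_unitVec_eq (w := ‖w‖⁻¹ • w)
    (by rw [norm_smul, norm_inv, norm_norm, inv_mul_cancel₀ hpos.ne']) a
  have h1 := h θ hθ
  rw [hθw, real_inner_smul_right, real_inner_smul_right, ← hfw, ← hfw] at h1
  have h2 := le_of_mul_le_mul_left h1 (inv_pos.2 hpos)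
  linarith [hf _ (hX.mem θ)]

/-- At a vertex the two extreme supporting half-planes imply all those in between. -/
theorem inner_le_of_vertex {a b θ : ℝ} {y : Plane} (hab : a < b) (hb : b < a + π)
    (hθ : θ ∈ Icc a b) (hXθ : X θ = X a) (hXb : X b = X a)
    (ha : ⟪y, unitVec a⟫ ≤ ⟪X a, unitVec a⟫) (hb' : ⟪y, unitVec b⟫ ≤ ⟪X b, unitVec b⟫) :
    ⟪y, unitVec θ⟫ ≤ ⟪X θ, unitVec θ⟫ := by
  have hs : 0 < Real.sin (b - a) := Real.sin_pos_of_pos_of_lt_pi (by linarith) (by linarith)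
  have h1 : 0 ≤ Real.sin (b - θ) :=
    Real.sin_nonneg_of_nonneg_of_le_pi (by linarith [hθ.2]) (by linarith [hθ.1])
  have h2 : 0 ≤ Real.sin (θ - a) :=
    Real.sin_nonneg_of_nonneg_of_le_pi (by linarith [hθ.1]) (by linarith [hθ.2])
  rw [hXb] at hb'
  refine le_of_mul_le_mul_left ?_ hs
  rw [hXθ, sin_mul_inner_unitVec, sin_mul_inner_unitVec (X a)]
  gcongr

/-- A body whose normalized radius of curvature is `0` on two opposite intervals of normal angles
and `1` elsewhere is a lens. -/
theorem exists_lens_of_gap (hX : IsSupportCurve R K X) (hR : 0 < R) (hK : IsClosed K)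
    (hconv : Convex ℝ K) {m α : ℝ} (hm0 : 0 < m) (hmπ : m < π)
    (hhalf : ∀ a, turnLength R X (a + π) - turnLength R X a = m)
    (hgap : turnLength R X (α + (π - m)) = turnLength R X α) :
    ∃ c₁ c₂ : Plane, c₁ ≠ c₂ ∧ K = Metric.closedBall c₁ R ∩ Metric.closedBall c₂ R := by
  set S := turnLength R X with hSdef
  have hS := hX.isUnitPrimitive hR
  rw [← hSdef] at hS
  set β := α + (π - m) with hβ
  have hconst : ∀ x y θ, S y = S x → θ ∈ Icc x y → X θ = X x := by
    intro x y θ hxy hθ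
    have h1 := hX.norm_sub_le_integral hR hθ.1
    rw [hX.integral_curvRadius hR] at h1
    have h2 : S θ ≤ S x := hxy ▸ hS.monotone hθ.2
    have h3 : ‖X θ - X x‖ ≤ 0 := h1.trans (mul_nonpos_of_nonneg_of_nonpos hR.le (by linarith))
    exact sub_eq_zero.1 (norm_le_zero_iff.1 h3)
  have hfull : ∀ x y θ, S y - S x = y - x → θ ∈ Icc x y → S y - S θ = y - θ := by
    intro x y θ hxy hθ
    have h1 := hS.sub_le hθ.1
    have h2 := hS.sub_le hθ.2
    linarith
  have hβπ := hhalf (β - π)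
  rw [sub_add_cancel] at hβπ
  have hαπ := hhalf α
  have hβπ' := hhalf β
  set c₁ := X α - R • unitVec α with hc₁
  set c₂ := X (α + π) - R • unitVec (α + π) with hc₂
  -- The gap takes nothing from the turn `m` of a half, so the remaining interval, of length `m`,
  -- has full density.
  have harc₁ : ∀ θ ∈ Icc (β - π) α, X θ - R • unitVec θ = c₁ := fun θ hθ =>
    (hX.center_eq_of_full hR hθ.2 (hfull (β - π) α θ (by linarith) hθ)).symm
  have harc₂ : ∀ θ ∈ Icc β (α + π), X θ - R • unitVec θ = c₂ := fun θ hθ =>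
    (hX.center_eq_of_full hR hθ.2 (hfull β (α + π) θ (by linarith) hθ)).symm
  have hXβ : X β = X α := hconst α β β hgap ⟨by linarith, le_rfl⟩
  have hβc : X β - R • unitVec β = c₂ := harc₂ β ⟨le_rfl, by linarith⟩
  refine ⟨c₁, c₂, fun hcc => ?_, Subset.antisymm (fun y hy => ⟨hX.ball α hy, hX.ball (α + π) hy⟩)
    fun y hy => ?_⟩
  -- Both arcs pass through the vertex `X α = X β`, with normals that differ by `π - m`.
  · rw [← hβc, hc₁, hXβ, sub_right_inj] at hcc
    have h1 : unitVec α = unitVec β := smul_right_injective _ hR.ne' hcc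
    have h2 : Real.cos (β - α) = 1 := by
      rw [← inner_unitVec_unitVec, h1, inner_unitVec_unitVec, sub_self, Real.cos_zero]
    have h3 := (Real.cos_eq_one_iff_of_lt_of_lt (by linarith) (by linarith)).1 h2
    linarith
  · have hdisk : ∀ c : Plane, y ∈ Metric.closedBall c R → ∀ θ, X θ - R • unitVec θ = c →
        ⟪y, unitVec θ⟫ ≤ ⟪X θ, unitVec θ⟫ := by
      intro c hyc θ hθ
      have h1 : ⟪y - c, unitVec θ⟫ ≤ R := by
        refine (real_inner_le_norm _ _).trans ?_
        rw [norm_unitVec, mul_one]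
        exact mem_closedBall_iff_norm.1 hyc
      rw [← hθ, inner_sub_left, inner_sub_left, real_inner_smul_left, inner_unitVec_unitVec,
        sub_self, Real.cos_zero] at h1
      linarith
    refine hX.mem_of_forall_inner_le hK hconv (β - π) fun θ hθ => ?_
    have hend : ⟪y, unitVec (β + π)⟫ ≤ ⟪X (β + π), unitVec (β + π)⟫ := by
      have h1 := hdisk _ hy.1 _ (harc₁ (β - π) ⟨le_rfl, by linarith⟩)
      rw [show β + π = β - π + 2 * π by ring, unitVec_add_two_pi, hX.periodic hR]
      exact h1
    -- The period from `β - π` to `β + π` consists of an arc, a vertex, the other arc and the other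
    -- vertex.
    rcases le_total θ α with h1 | h1
    · exact hdisk _ hy.1 _ (harc₁ θ ⟨hθ.1, h1⟩)
    rcases le_total θ β with h2 | h2
    · exact inner_le_of_vertex (by linarith) (by linarith) ⟨h1, h2⟩
        (hconst α β θ hgap ⟨h1, h2⟩) hXβ (hdisk _ hy.1 α rfl) (hdisk _ hy.2 β hβc)
    rcases le_total θ (α + π) with h3 | h3
    · exact hdisk _ hy.2 _ (harc₂ θ ⟨h2, h3⟩)
    · have hgap' : S (β + π) = S (α + π) := by linarith
      have hθβ : θ ≤ β + π := by linarith [hθ.2]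
      exact inner_le_of_vertex (a := α + π) (b := β + π) (by linarith) (by linarith) ⟨h3, hθβ⟩
        (hconst _ _ θ hgap' ⟨h3, hθβ⟩) (hconst _ _ _ hgap' ⟨by linarith, le_rfl⟩)
        (hdisk _ hy.2 _ rfl) hend

/-- The area of a body all of whose supporting disks of radius `R` contain it, in terms of the half
perimeter. -/
theorem sub_sin_le_volume (hX : IsSupportCurve R K X) (hR : 0 < R) (hconv : Convex ℝ K)
    (hint : (interior K).Nonempty) {m : ℝ}
    (hm : ∀ a, turnLength R X (a + 2 * π) - turnLength R X a = 2 * m) :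
    ENNReal.ofReal (R ^ 2 * (m - Real.sin m)) ≤ volume K := by
  obtain ⟨p, hp⟩ := hint
  have hS := hX.isUnitPrimitive hR
  refine le_trans (ENNReal.ofReal_le_ofReal ?_) (hX.integral_le_volume hR hconv hp 0)
  rw [hX.integral_eq_halves hR]
  have q1 := hS.sub_sin_le_integral 0
  have q2 := hS.sub_sin_le_integral (0 + π)
  obtain ⟨b1, b2⟩ := hS.half_bounds 0
  obtain ⟨b3, b4⟩ := hS.half_bounds (0 + π)
  have hcv := two_mul_sub_sin_le b1 b3 b2 b4
  have hm0 := hm 0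
  rw [show (0 : ℝ) + 2 * π = 0 + π + π by ring] at hm0
  rw [show (turnLength R X (0 + π) - turnLength R X 0 +
    (turnLength R X (0 + π + π) - turnLength R X (0 + π))) / 2 = m by linarith] at hcv
  have hR2 : 0 < R ^ 2 := by positivity
  rw [mul_left_comm]
  exact mul_le_mul_of_nonneg_left (by linarith) hR2.le

/-- The area attains the lower bound coming from every cut, so for each `a` the convexity inequality
and both half estimates are equalities. -/
theorem exists_lens_of_volume_eq (hX : IsSupportCurve R K X) (hR : 0 < R) (hK : IsClosed K)
    (hconv : Convex ℝ K) (hint : (interior K).Nonempty) {m : ℝ} (hm0 : 0 < m) (hmπ : m < π)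
    (hm : ∀ a, turnLength R X (a + 2 * π) - turnLength R X a = 2 * m)
    (hvol : volume K = ENNReal.ofReal (R ^ 2 * (m - Real.sin m))) :
    ∃ c₁ c₂ : Plane, c₁ ≠ c₂ ∧ K = Metric.closedBall c₁ R ∩ Metric.closedBall c₂ R := by
  obtain ⟨p, hp⟩ := hint
  have hS := hX.isUnitPrimitive hR
  have hR2 : 0 < R ^ 2 := by positivity
  have hkey : ∀ a, turnLength R X (a + π) - turnLength R X a = m ∧
      ∫ θ in a..a + π, (∫ t in a..θ, Real.sin (θ - t) * (curvRadius X t / R)) *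
        (curvRadius X θ / R) = m - Real.sin m := by
    intro a
    have h1 := hX.integral_le_volume hR hconv hp a
    rw [hvol, ENNReal.ofReal_le_ofReal_iff (mul_nonneg hR2.le
      (sub_nonneg.2 (Real.sin_le hm0.le))), hX.integral_eq_halves hR, mul_left_comm] at h1
    have h2 := le_of_mul_le_mul_left h1 hR2
    have q1 := hS.sub_sin_le_integral a
    have q2 := hS.sub_sin_le_integral (a + π)
    obtain ⟨b1, b2⟩ := hS.half_bounds a
    obtain ⟨b3, b4⟩ := hS.half_bounds (a + π)
    have hma := hm a
    rw [show a + 2 * π = a + π + π by ring] at hma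
    have hmid : (turnLength R X (a + π) - turnLength R X a +
      (turnLength R X (a + π + π) - turnLength R X (a + π))) / 2 = m := by linarith
    have heq := eq_of_sub_sin_le b1 b3 b2 b4 (by rw [hmid]; linarith)
    have hl1 : turnLength R X (a + π) - turnLength R X a = m := by linarith
    have hl2 : turnLength R X (a + π + π) - turnLength R X (a + π) = m := by linarith
    rw [hl1] at q1
    rw [hl2] at q2
    exact ⟨hl1, le_antisymm (by linarith) q1⟩
  obtain ⟨α, hα⟩ := hS.exists_gap hm0 hmπ (fun a => (hkey a).1) (hkey 0).2
  exact hX.exists_lens_of_gap hR hK hconv hm0 hmπ (fun a => (hkey a).1) hα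

end IsSupportCurve

/-! ### Boundary, perimeter and area of a lens. -/

/-- A boundary point lies on one of the two circles, and the disk of that circle contains all of
`L`. -/
theorem IsLambdaConvexLens.isLambdaConvexBody {lam : ℝ} {L : Set Plane}
    (hL : IsLambdaConvexLens lam L) : IsLambdaConvexBody lam L := by
  obtain ⟨c₁, c₂, -, hL, hint⟩ := hL
  have hsub₁ : L ⊆ Metric.closedBall c₁ (1 / lam) := hL ▸ inter_subset_left
  have hsub₂ : L ⊆ Metric.closedBall c₂ (1 / lam) := hL ▸ inter_subset_right
  have hcl : IsClosed L := by
    rw [hL]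
    exact Metric.isClosed_closedBall.inter Metric.isClosed_closedBall
  refine ⟨?_, ?_, hint, fun p hp => ?_⟩
  · rw [hL]
    exact (isCompact_closedBall _ _).inter (isCompact_closedBall _ _)
  · rw [hL]
    exact (convex_closedBall _ _).inter (convex_closedBall _ _)
  · have hpL : p ∈ L := hcl.frontier_subset hp
    by_cases h₁ : dist p c₁ = 1 / lam
    · exact ⟨univ, univ_mem, c₁, h₁, fun y hy => hsub₁ (hcl.frontier_subset hy.2)⟩
    by_cases h₂ : dist p c₂ = 1 / lam
    · exact ⟨univ, univ_mem, c₂, h₂, fun y hy => hsub₂ (hcl.frontier_subset hy.2)⟩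
    refine absurd (mem_interior.2 ⟨Metric.ball c₁ (1 / lam) ∩ Metric.ball c₂ (1 / lam), ?_,
      Metric.isOpen_ball.inter Metric.isOpen_ball, ?_⟩) hp.2
    · rw [hL]
      exact inter_subset_inter Metric.ball_subset_closedBall Metric.ball_subset_closedBall
    · exact ⟨lt_of_le_of_ne (hsub₁ hpL) h₁, lt_of_le_of_ne (hsub₂ hpL) h₂⟩

/-- The two disks of a lens in symmetric position. -/
theorem exists_lens_frame {R : ℝ} (hR : 0 < R) {c₁ c₂ : Plane} (hne : c₁ ≠ c₂)
    (hint : (interior (Metric.closedBall c₁ R ∩ Metric.closedBall c₂ R)).Nonempty) :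
    ∃ q ω φ, φ ∈ Ioo 0 (π / 2) ∧ c₁ = q - (R * Real.cos φ) • unitVec ω ∧
      c₂ = q + (R * Real.cos φ) • unitVec ω := by
  have hpos : 0 < ‖c₂ - c₁‖ := norm_pos_iff.2 (sub_ne_zero.2 hne.symm)
  set q := (1 / 2 : ℝ) • (c₁ + c₂) with hq
  set d := ‖c₂ - c₁‖ / 2 with hd
  obtain ⟨ω, -, hω⟩ := exists_unitVec_eq (w := ‖c₂ - c₁‖⁻¹ • (c₂ - c₁))
    (by rw [norm_smul, norm_inv, norm_norm, inv_mul_cancel₀ hpos.ne']) 0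
  have hdω : d • unitVec ω = (1 / 2 : ℝ) • (c₂ - c₁) := by
    rw [hω, smul_smul, hd]; congr 1; field_simp
  have hc₁ : c₁ = q - d • unitVec ω := by rw [hdω, hq]; module
  have hc₂ : c₂ = q + d • unitVec ω := by rw [hdω, hq]; module
  have hdR : d < R := by
    -- For centres at distance at least `2R` the parallelogram law leaves at most the midpoint in
    -- the intersection.
    by_contra! hle
    have hsub : Metric.closedBall c₁ R ∩ Metric.closedBall c₂ R ⊆ {q} := by
      rintro y ⟨h1, h2⟩
      rw [mem_closedBall_iff_norm] at h1 h2
      have e1 : y - c₁ = (y - q) + d • unitVec ω := by rw [hc₁]; abel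
      have e2 : y - c₂ = (y - q) - d • unitVec ω := by rw [hc₂]; abel
      have hpar := parallelogram_law_with_norm ℝ (y - q) (d • unitVec ω)
      rw [← e1, ← e2, norm_smul, norm_unitVec, mul_one,
        Real.norm_of_nonneg (by positivity : 0 ≤ d)] at hpar
      have s1 := mul_self_le_mul_self (norm_nonneg _) h1
      have s2 := mul_self_le_mul_self (norm_nonneg _) h2
      have s3 := mul_self_le_mul_self hR.le hle
      have h0 : ‖y - q‖ * ‖y - q‖ = 0 :=
        le_antisymm (by linarith) (mul_self_nonneg _)
      exact sub_eq_zero.1 (norm_eq_zero.1 (mul_self_eq_zero.1 h0))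
    obtain ⟨y, hy⟩ := hint
    have := interior_mono hsub hy
    rw [interior_singleton] at this
    exact this
  have hd0 : 0 < d := by positivity
  have hcos : R * Real.cos (Real.arccos (d / R)) = d := by
    rw [Real.cos_arccos (by linarith [div_nonneg hd0.le hR.le]) ((div_le_one hR).2 hdR.le)]
    field_simp
  -- `φ` is half the angle under which an arc of the lens is seen from its centre.
  refine ⟨q, ω, Real.arccos (d / R), ⟨?_, ?_⟩, ?_, ?_⟩
  · rw [Real.arccos_pos]; exact (div_lt_one hR).2 hdR
  · rw [Real.arccos_lt_pi_div_two]; positivity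
  · rw [hcos]; exact hc₁
  · rw [hcos]; exact hc₂

section Lens

variable {R φ ω : ℝ} {q : Plane} {X : ℝ → Plane} {L : Set Plane}

theorem arc_mem_closedBall (hR : 0 < R) (hφ : φ ∈ Ioo 0 (π / 2)) {θ : ℝ}
    (hθ : θ ∈ Icc (ω - φ) (ω + φ)) :
    ‖(q - (R * Real.cos φ) • unitVec ω + R • unitVec θ) -
      (q + (R * Real.cos φ) • unitVec ω)‖ ≤ R := by
  have hcosφ : 0 < Real.cos φ := Real.cos_pos_of_mem_Ioo ⟨by linarith [hφ.1, Real.pi_pos], hφ.2⟩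
  have hcos : Real.cos φ ≤ Real.cos (θ - ω) := by
    rw [← Real.cos_abs (θ - ω)]
    exact Real.cos_le_cos_of_nonneg_of_le_pi (abs_nonneg _) (by linarith [hφ.2, Real.pi_pos])
      (abs_le.2 ⟨by linarith [hθ.1], by linarith [hθ.2]⟩)
  have e : (q - (R * Real.cos φ) • unitVec ω + R • unitVec θ) -
      (q + (R * Real.cos φ) • unitVec ω) =
      R • (unitVec θ - (2 * Real.cos φ) • unitVec ω) := by module
  have h1 : ‖unitVec θ - (2 * Real.cos φ) • unitVec ω‖ ^ 2 ≤ 1 := by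
    rw [norm_sub_sq_real, norm_smul, norm_unitVec, norm_unitVec, real_inner_smul_right,
      inner_unitVec_unitVec, Real.norm_of_nonneg (by positivity)]
    nlinarith
  rw [e, norm_smul, Real.norm_of_nonneg hR.le]
  have h2 : ‖unitVec θ - (2 * Real.cos φ) • unitVec ω‖ ≤ 1 :=
    (sq_le_one_iff₀ (norm_nonneg _)).1 h1
  exact mul_le_of_le_one_right hR.le h2

/-- The point of the disk extreme in direction `θ` is also extreme for the smaller set `L` as soon
as it belongs to `L`. -/
theorem IsSupportCurve.eq_arc (hX : IsSupportCurve R L X) (hR : 0 < R) {c : Plane} {θ : ℝ}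
    (hsub : L ⊆ Metric.closedBall c R) (hmem : c + R • unitVec θ ∈ L) :
    X θ = c + R • unitVec θ := by
  refine (hX.eq_of_inner_eq hR θ hmem (le_antisymm (hX.support θ _ hmem) ?_)).symm
  have h1 : ⟪X θ - c, unitVec θ⟫ ≤ R := by
    refine (real_inner_le_norm _ _).trans ?_
    rw [norm_unitVec, mul_one]
    exact mem_closedBall_iff_norm.1 (hsub (hX.mem θ))
  rw [inner_sub_left] at h1
  rw [inner_add_left, real_inner_smul_left, inner_unitVec_unitVec, sub_self, Real.cos_zero]
  linarith

/-- The boundary curve of a lens: two arcs joined at two vertices. -/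
theorem IsSupportCurve.lens_curve (hX : IsSupportCurve R L X) (hR : 0 < R)
    (hφ : φ ∈ Ioo 0 (π / 2))
    (hL : L = Metric.closedBall (q - (R * Real.cos φ) • unitVec ω) R ∩
      Metric.closedBall (q + (R * Real.cos φ) • unitVec ω) R) :
    (∀ θ ∈ Icc (ω - φ) (ω + φ), X θ = q - (R * Real.cos φ) • unitVec ω + R • unitVec θ) ∧
    (∀ θ ∈ Icc (ω + φ) (ω + π - φ), X θ = X (ω + φ)) ∧
    (∀ θ ∈ Icc (ω + π - φ) (ω + π + φ),
      X θ = q + (R * Real.cos φ) • unitVec ω + R • unitVec θ) ∧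
    (∀ θ ∈ Icc (ω + π + φ) (ω - φ + 2 * π), X θ = X (ω + π + φ)) := by
  obtain ⟨hφ0, hφ2⟩ := hφ
  have hsub₁ : L ⊆ Metric.closedBall (q - (R * Real.cos φ) • unitVec ω) R :=
    hL ▸ inter_subset_left
  have hsub₂ : L ⊆ Metric.closedBall (q + (R * Real.cos φ) • unitVec ω) R :=
    hL ▸ inter_subset_right
  have harc₁ : ∀ θ ∈ Icc (ω - φ) (ω + φ),
      X θ = q - (R * Real.cos φ) • unitVec ω + R • unitVec θ := fun θ hθ => by
    refine hX.eq_arc hR hsub₁ ?_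
    rw [hL]
    refine ⟨?_, mem_closedBall_iff_norm.2 (arc_mem_closedBall hR ⟨hφ0, hφ2⟩ hθ)⟩
    rw [mem_closedBall_iff_norm, add_sub_cancel_left, norm_smul, norm_unitVec, mul_one,
      Real.norm_of_nonneg hR.le]
  have harc₂ : ∀ θ ∈ Icc (ω + π - φ) (ω + π + φ),
      X θ = q + (R * Real.cos φ) • unitVec ω + R • unitVec θ := fun θ hθ => by
    refine hX.eq_arc hR hsub₂ ?_
    rw [hL]
    constructor
    · have h := arc_mem_closedBall (q := q) (ω := ω + π) hR ⟨hφ0, hφ2⟩ hθ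
      rw [unitVec_add_pi, smul_neg, sub_neg_eq_add, ← sub_eq_add_neg] at h
      exact mem_closedBall_iff_norm.2 h
    · rw [mem_closedBall_iff_norm, add_sub_cancel_left, norm_smul, norm_unitVec, mul_one,
        Real.norm_of_nonneg hR.le]
  -- The arcs meet at the vertices; used with `ψ = φ` and `ψ = -φ`.
  have hv : ∀ ψ : ℝ, Real.cos ψ = Real.cos φ →
      q - (R * Real.cos φ) • unitVec ω + R • unitVec (ω + ψ) =
      q + (R * Real.cos φ) • unitVec ω + R • unitVec (ω + π - ψ) := fun ψ hψ => by
    have h1 : unitVec (ω + ψ) = (2 * Real.cos ψ) • unitVec ω + unitVec (ω + π - ψ) := by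
      rw [show ω + π - ψ = ω - ψ + π by ring]
      apply plane_ext
      · simp [Real.cos_add, Real.cos_sub]; ring
      · simp [Real.sin_add, Real.sin_sub]; ring
    rw [h1, hψ]; module
  have hV₁ : X (ω + φ) = X (ω + π - φ) := by
    rw [harc₁ _ ⟨by linarith, le_rfl⟩, harc₂ _ ⟨le_rfl, by linarith⟩, hv φ rfl]
  have hV₂ : X (ω + π + φ) = X (ω - φ + 2 * π) := by
    rw [hX.periodic hR, harc₁ _ ⟨le_rfl, by linarith⟩, harc₂ _ ⟨by linarith, le_rfl⟩,
      sub_eq_add_neg ω φ, hv (-φ) (Real.cos_neg φ), sub_neg_eq_add]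
  exact ⟨harc₁, fun θ hθ => hX.eq_of_eq hR (by linarith) hV₁ hθ, harc₂,
    fun θ hθ => hX.eq_of_eq hR (by linarith) hV₂ hθ⟩

theorem hasDerivAt_arc {a b θ : ℝ} {c : Plane} (h : ∀ θ ∈ Icc a b, X θ = c + R • unitVec θ)
    (hθ : θ ∈ Ioo a b) : HasDerivAt X (R • tangentVec θ) θ :=
  (((hasDerivAt_unitVec θ).const_smul R).const_add c).congr_of_eventuallyEq <| by
    filter_upwards [Ioo_mem_nhds hθ.1 hθ.2] with t ht
    exact h t (Ioo_subset_Icc_self ht)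

theorem hasDerivAt_vertex {a b θ : ℝ} {c : Plane} (h : ∀ θ ∈ Icc a b, X θ = c)
    (hθ : θ ∈ Ioo a b) : HasDerivAt X 0 θ :=
  (hasDerivAt_const θ c).congr_of_eventuallyEq <| by
    filter_upwards [Ioo_mem_nhds hθ.1 hθ.2] with t ht
    exact h t (Ioo_subset_Icc_self ht)

theorem curvRadius_arc {a b θ : ℝ} {c : Plane} (h : ∀ θ ∈ Icc a b, X θ = c + R • unitVec θ)
    (hθ : θ ∈ Ioo a b) : curvRadius X θ = R := by
  rw [curvRadius, (hasDerivAt_arc h hθ).deriv, real_inner_smul_left, inner_tangentVec_tangentVec,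
    sub_self, Real.cos_zero, mul_one]

theorem curvRadius_vertex {a b θ : ℝ} {c : Plane} (h : ∀ θ ∈ Icc a b, X θ = c)
    (hθ : θ ∈ Ioo a b) : curvRadius X θ = 0 := by
  rw [curvRadius, (hasDerivAt_vertex h hθ).deriv, inner_zero_left]

theorem integral_congr_Ioo {f g : ℝ → ℝ} {a b : ℝ} (hab : a ≤ b) (h : ∀ x ∈ Ioo a b, f x = g x) :
    ∫ x in a..b, f x = ∫ x in a..b, g x := by
  apply intervalIntegral.integral_congr_ae
  have hne : ∀ᵐ x, x ≠ b := by simp [ae_iff, measure_singleton]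
  filter_upwards [hne] with x hxb hx
  rw [uIoc_of_le hab] at hx
  exact h x ⟨hx.1, lt_of_le_of_ne hx.2 hxb⟩

theorem integral_density_arc {a b : ℝ} (hab : a ≤ b) {c : Plane}
    (h : ∀ θ ∈ Icc a b, X θ = c + R • unitVec θ) (p : Plane) :
    ∫ θ in a..b, ⟪X θ - p, unitVec θ⟫ * curvRadius X θ =
      R * (⟪c - p, tangentVec a⟫ - ⟪c - p, tangentVec b⟫ + R * (b - a)) := by
  have h1 : ∀ θ ∈ Ioo a b, ⟪X θ - p, unitVec θ⟫ * curvRadius X θ =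
      R * (⟪c - p, unitVec θ⟫ + R) := fun θ hθ => by
    rw [curvRadius_arc h hθ, h θ (Ioo_subset_Icc_self hθ), add_sub_right_comm, inner_add_left,
      real_inner_smul_left, inner_unitVec_unitVec, sub_self, Real.cos_zero]
    ring
  rw [integral_congr_Ioo hab h1, intervalIntegral.integral_const_mul]
  congr 1
  have h2 : ∀ θ ∈ uIcc a b, HasDerivAt (fun θ => R * θ - ⟪c - p, tangentVec θ⟫)
      (⟪c - p, unitVec θ⟫ + R) θ := fun θ _ => by
    have h3 : HasDerivAt (fun θ => ⟪c - p, tangentVec θ⟫) (-⟪c - p, unitVec θ⟫) θ := by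
      have := (hasDerivAt_const θ (c - p)).inner ℝ (hasDerivAt_tangentVec θ)
      simpa using this
    refine (((hasDerivAt_id θ).const_mul R).sub h3).congr_deriv ?_
    ring
  rw [intervalIntegral.integral_eq_sub_of_hasDerivAt h2
    (((continuous_const.inner continuous_unitVec).add continuous_const).intervalIntegrable _ _)]
  ring

theorem integral_density_vertex {a b : ℝ} (hab : a ≤ b) {c : Plane}
    (h : ∀ θ ∈ Icc a b, X θ = c) (p : Plane) :
    ∫ θ in a..b, ⟪X θ - p, unitVec θ⟫ * curvRadius X θ = 0 := by
  rw [integral_congr_Ioo (g := fun _ => 0) hab fun θ hθ => by rw [curvRadius_vertex h hθ, mul_zero],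
    intervalIntegral.integral_zero]

theorem integral_curvRadius_arc {a b : ℝ} (hab : a ≤ b) {c : Plane}
    (h : ∀ θ ∈ Icc a b, X θ = c + R • unitVec θ) :
    ∫ θ in a..b, curvRadius X θ = R * (b - a) := by
  rw [integral_congr_Ioo (g := fun _ => R) hab fun θ hθ => curvRadius_arc h hθ,
    intervalIntegral.integral_const, smul_eq_mul, mul_comm]

theorem integral_curvRadius_vertex {a b : ℝ} (hab : a ≤ b) {c : Plane}
    (h : ∀ θ ∈ Icc a b, X θ = c) : ∫ θ in a..b, curvRadius X θ = 0 := by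
  rw [integral_congr_Ioo (g := fun _ => 0) hab fun θ hθ => curvRadius_vertex h hθ,
    intervalIntegral.integral_zero]

end Lens

theorem integral_add_four {f : ℝ → ℝ} (hf : ∀ a b, IntervalIntegrable f volume a b)
    (a b c d e : ℝ) : ∫ x in a..e, f x =
      (∫ x in a..b, f x) + (∫ x in b..c, f x) + (∫ x in c..d, f x) + ∫ x in d..e, f x := by
  rw [intervalIntegral.integral_add_adjacent_intervals (hf _ _) (hf _ _),
    intervalIntegral.integral_add_adjacent_intervals (hf _ _) (hf _ _),
    intervalIntegral.integral_add_adjacent_intervals (hf _ _) (hf _ _)]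

/-- Perimeter and area of a lens. -/
theorem IsLambdaConvexLens.exists_perimeter_volume {lam : ℝ} (hlam : 0 < lam) {L : Set Plane}
    (hL : IsLambdaConvexLens lam L) :
    ∃ m ∈ Ioo 0 π, perimeter L = ENNReal.ofReal (2 * (1 / lam) * m) ∧
      volume L ≤ ENNReal.ofReal ((1 / lam) ^ 2 * (m - Real.sin m)) := by
  have hbody := hL.isLambdaConvexBody
  obtain ⟨X, hX⟩ := hbody.exists_isSupportCurve hlam
  obtain ⟨c₁, c₂, hne, hLe, hint⟩ := hL
  set R := 1 / lam with hRdef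
  have hR : 0 < R := by positivity
  obtain ⟨q, ω, φ, hφ, hc₁, hc₂⟩ := exists_lens_frame hR hne (hLe ▸ hint)
  rw [hc₁, hc₂] at hLe
  obtain ⟨harc₁, hver₁, harc₂, hver₂⟩ := hX.lens_curve hR hφ hLe
  obtain ⟨hφ0, hφ2⟩ := hφ
  have hcosφ : 0 < Real.cos φ := Real.cos_pos_of_mem_Ioo ⟨by linarith, hφ2⟩
  have hcosφ1 : Real.cos φ < 1 := by
    rw [← Real.cos_zero]
    exact Real.cos_lt_cos_of_nonneg_of_le_pi_div_two le_rfl hφ2.le hφ0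
  have hq : q ∈ interior L := by
    have hopen : IsOpen (Metric.ball (q - (R * Real.cos φ) • unitVec ω) R ∩
        Metric.ball (q + (R * Real.cos φ) • unitVec ω) R) :=
      Metric.isOpen_ball.inter Metric.isOpen_ball
    have hlt : R * Real.cos φ < R := mul_lt_of_lt_one_right hR hcosφ1
    refine mem_interior.2 ⟨_, ?_, hopen, ?_⟩
    · rw [hLe]
      exact inter_subset_inter Metric.ball_subset_closedBall Metric.ball_subset_closedBall
    · constructor
      · rw [mem_ball_iff_norm, sub_sub_cancel, norm_smul, norm_unitVec, mul_one,
          Real.norm_of_nonneg (by positivity)]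
        exact hlt
      · rw [mem_ball_iff_norm, sub_add_cancel_left, norm_neg, norm_smul, norm_unitVec, mul_one,
          Real.norm_of_nonneg (by positivity)]
        exact hlt
  have l1 : ω - φ ≤ ω + φ := by linarith
  have l2 : ω + φ ≤ ω + π - φ := by linarith
  have l3 : ω + π - φ ≤ ω + π + φ := by linarith
  have l4 : ω + π + φ ≤ ω - φ + 2 * π := by linarith
  -- Each of the two arcs turns by `2 * φ`, so half the perimeter is `R * (2 * φ)`.
  refine ⟨2 * φ, ⟨by linarith, by linarith⟩, ?_, ?_⟩
  · rw [hX.perimeter_eq hR hbody.isCompact.isClosed hbody.convex hint (ω - φ)]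
    congr 1
    rw [integral_add_four (hX.intervalIntegrable_curvRadius hR) (ω - φ) (ω + φ) (ω + π - φ)
      (ω + π + φ), integral_curvRadius_arc l1 harc₁, integral_curvRadius_vertex l2 hver₁,
      integral_curvRadius_arc l3 harc₂, integral_curvRadius_vertex l4 hver₂]
    ring
  -- Differentiability can fail only at the four normals where arcs and vertices meet.
  · have hdiff : ∀ θ ∈ Ico (ω - φ) (ω - φ + 2 * π) \ {ω - φ, ω + φ, ω + π - φ, ω + π + φ},
        DifferentiableAt ℝ X θ := by
      rintro θ ⟨hθ, hθC⟩
      simp only [mem_insert_iff, mem_singleton_iff, not_or] at hθC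
      obtain ⟨n1, n2, n3, n4⟩ := hθC
      rcases lt_or_gt_of_ne n2 with h2 | h2
      · exact (hasDerivAt_arc harc₁ ⟨lt_of_le_of_ne hθ.1 (Ne.symm n1), h2⟩).differentiableAt
      rcases lt_or_gt_of_ne n3 with h3 | h3
      · exact (hasDerivAt_vertex hver₁ ⟨h2, h3⟩).differentiableAt
      rcases lt_or_gt_of_ne n4 with h4 | h4
      · exact (hasDerivAt_arc harc₂ ⟨h3, h4⟩).differentiableAt
      · exact (hasDerivAt_vertex hver₂ ⟨h4, hθ.2⟩).differentiableAt
    refine (hX.volume_le_integral hR hbody.isCompact hbody.convex hq (ω - φ)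
      (toFinite _).countable hdiff).trans (ENNReal.ofReal_le_ofReal (le_of_eq ?_))
    rw [integral_add_four (hX.intervalIntegrable_density hR q) (ω - φ) (ω + φ) (ω + π - φ)
      (ω + π + φ), integral_density_arc l1 harc₁, integral_density_vertex l2 hver₁,
      integral_density_arc l3 harc₂, integral_density_vertex l4 hver₂]
    rw [sub_sub_cancel_left, add_sub_cancel_left]
    simp only [inner_neg_left, real_inner_smul_left, inner_unitVec_tangentVec]
    rw [show ω - (ω - φ) = φ by ring, show ω - (ω + φ) = -φ by ring,
      show ω - (ω + π - φ) = φ - π by ring, show ω - (ω + π + φ) = -(φ + π) by ring,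
      Real.sin_neg, Real.sin_neg, Real.sin_sub_pi, Real.sin_add_pi, Real.sin_two_mul]
    ring

/-! ### Comparison of the body with the lens. -/

theorem mainTheorem4 (lam : ℝ) (hlam : 0 < lam) (K L : Set (EuclideanSpace ℝ (Fin 2)))
    (hK : IsLambdaConvexBody lam K) (hL : IsLambdaConvexLens lam L)
    (hKL : perimeter K = perimeter L) :
    volume L ≤ volume K ∧ (volume K = volume L → IsLambdaConvexLens lam K) := by
  obtain ⟨m, ⟨hm0, hmπ⟩, hper, hvol⟩ := hL.exists_perimeter_volume hlam
  obtain ⟨X, hX⟩ := hK.exists_isSupportCurve hlam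
  have hR : 0 < 1 / lam := by positivity
  have hclosed := hK.isCompact.isClosed
  -- Equal perimeters give `K` the total turn `2 * m` of the lens, over every period.
  have hm : ∀ a, turnLength (1 / lam) X (a + 2 * π) - turnLength (1 / lam) X a = 2 * m := by
    intro a
    have h1 := hX.perimeter_eq hR hclosed hK.convex hK.interior_nonempty a
    have hle : a ≤ a + 2 * π := by linarith [Real.pi_pos]
    rw [hKL, hper, ENNReal.ofReal_eq_ofReal_iff (by positivity)
      (intervalIntegral.integral_nonneg hle fun t _ => hX.curvRadius_nonneg t),
      hX.integral_curvRadius hR] at h1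
    refine mul_left_cancel₀ hR.ne' ?_
    linarith
  have hlow := hX.sub_sin_le_volume hR hK.convex hK.interior_nonempty hm
  refine ⟨hvol.trans hlow, fun heq => ?_⟩
  obtain ⟨c₁, c₂, hne, hKe⟩ := hX.exists_lens_of_volume_eq hR hclosed hK.convex
    hK.interior_nonempty hm0 hmπ hm (le_antisymm (heq.trans_le hvol) hlow)
  exact ⟨c₁, c₂, hne, hKe, hK.interior_nonempty⟩
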